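/- Let $w_1,w_2,w_3$ be unit vectors in $\mathbb R^2$ with $w_1+w_2+w_3=0$ (indices mod $3$). **Measures.** For a measure $\mu$ on $\mathbb R^2$ that is a finite sum of nonnegative multiples of the length measure on (bounded or unbounded) intervals of lines parallel to some $w_j$, let $\delta_j^{\pm}(\mu,A)$ be the density of $\mu$ with respect to length on $\{A\pm tw_j:0<t<\eta\}$ for small $\eta>0$. Let $\mathcal M$ be the set of such $\mu$ for which $\delta_j^+(\mu,A)-\delta_j^-(\mu,A)$ does not depend on $j$, for every $A\in\mathbb R^2$. A branch point of $\mu$ is a point $A$ at which at least three of the six numbers $\delta_j^\pm(\mu,A)$ are nonzero. For $r>0$ let $\triangle_r$ be the closed triangle with vertices $X_1=rw_1$, $X_2=r(w_1+w_2)$, $X_3=0$, and let $\mathcal M_r$ be the set of all $\mu\in\mathcal M$ whose branch points lie in $\triangle_r$ and for which $\operatorname{supp}(\mu)\setminus\triangle_r$ is a finite union of half-lines $\{A+tw_j:t>0\}$ with $A\in\partial\triangle_r$. A point $A\in\partial\triangle_r$ with $\{A+tw_j:t>0\}\subset\operatorname{supp}(\mu)\setminus\triangle_r$ is an exit point of $\mu$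 in the direction $w_j$, with exit density $\delta_j^+(\mu,A)$. The sum of the exit densities in the direction $w_j$ is the same for $j=1,2,3$; it is the weight $\omega(\mu)$. An exit point is an attachment point if it is not a corner of $\triangle_r$, or if it is a corner and the half-line $\{A+tw_j:t>0\}$ parallel to the opposite side lies in $\operatorname{supp}(\mu)$. Every point of $\partial\triangle_r$ can be written in exactly one way as $X_j+xw_{j+1}$ with $j\in\{1,2,3\}$ and $x\in(0,r]$; we say that it has coordinate $x$ on the side $j$. The exit density at an attachment point on the side $j$ is the one in the direction $w_j$. **Trees.** Let $T$ be a tree with finitely many, and at least one, branch points, all of order three, and without vertices of order one; its unbounded edges are called leaves. Each edge and leaf has a type in $\{1,2,3\}$, and the three types around each branch point are distinct. An immersion of $T$ is a continuous map $f:T\to\mathbb R^2$ that maps each edge of type $j$ between two branch points homeomorphically onto a segment parallel to $w_j$ and each leaf of type $j$ homeomorphically onto a half-line parallel to $w_j$, such that the images of the three edges at each branch point leave it either in the directions $w_1,w_2,w_3$ or in the directions $-w_1,-w_2,-w_3$. The measure $\mu_f$ has, with respect to length, density at each point equal to its number of preimages under $f$. **Proposition.** Let $f$ be an immersion of $T$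 such that $\mu_f\in\mathcal M_r$ for some $r>0$. Let $A_1,\dots,A_q$ be the (distinct) attachment points of $\mu_f$, let $A_i$ have coordinate $x_i\in(0,r]$ on the side $s_i$, and let $\alpha_1,\dots,\alpha_q$ be the corresponding exit densities. For every $\varepsilon>0$ there exists $\delta>0$ with the following property. Let $r'>0$ and let $A_1',\dots,A_q'\in\partial\triangle_{r'}$, where $A_i'$ has coordinate $x_i'\in(0,r']$ on the side $s_i'$ of $\triangle_{r'}$, be such that $$\sum_{i=1}^q\alpha_ix_i'=\omega(\mu_f)\,r'\qquad\text{and}\qquad|A_i'-A_i|<\delta,\quad i=1,\dots,q,$$ and such that $|r'-r|<\delta$ or $s_i'=s_i$ for all $i$. Then there exists an immersion $g$ of $T$ such that $|f(t)-g(t)|<\varepsilon$ for all $t\in T$, $\mu_g\in\mathcal M_{r'}$, the attachment points of $\mu_g$ are exactly $A_1',\dots,A_q'$, and the exit density of $\mu_g$ at $A_i'$ is $\alpha_i$ for every $i$. -/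

import Mathlib

open Set Filter Topology MeasureTheory
open scoped NNReal ENNReal

noncomputable section

/-- The plane `ℝ²` with its Euclidean norm. -/
abbrev Plane : Type := EuclideanSpace ℝ (Fin 2)

/-! ### Measures supported on lines in three directions

Throughout, `w 0, w 1, w 2` are three unit vectors of the plane with sum `0`; the directions
`1, 2, 3` are numbered `0, 1, 2`, and indices are added modulo `3`. -/

/-- The open half-line `{A + t v : t > 0}`. -/
def ray (A v : Plane) : Set Plane := (fun t : ℝ => A + t • v) '' Ioi 0

/-- The open segment `{A + t v : t ∈ (0, e)}`. -/
def shortSeg (A v : Plane) (e : ℝ) : Set Plane := (fun t : ℝ => A + t • v) '' Ioo 0 e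

/-- The measure `m` is a finite sum of nonnegative multiples of the length measure on
(bounded or unbounded) intervals of lines parallel to `w 0`, `w 1` or `w 2`. -/
def IsPolygonal (w : Fin 3 → Plane) (m : Measure Plane) : Prop :=
  ∃ (n : ℕ) (C : Fin n → Set Plane) (c : Fin n → ℝ≥0),
    (∀ i, Convex ℝ (C i) ∧ ∃ (A : Plane) (j : Fin 3), C i ⊆ range (fun t : ℝ => A + t • w j)) ∧
    m = ∑ i, c i • (μH[1] : Measure Plane).restrict (C i)

/-- The density of `m` on the segment `{A + t v : t ∈ (0, e)}` for small `e`, where `v` is a unit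
vector. If `m` is polygonal and `v = ± w j` then the quotient is constant for small `e`. -/
def density (m : Measure Plane) (A v : Plane) : ℝ :=
  limUnder (𝓝[>] (0 : ℝ)) (fun e : ℝ => m.real (shortSeg A v e) / e)

/-- The cone of all polygonal measures that are balanced at every point. -/
def MemM (w : Fin 3 → Plane) (m : Measure Plane) : Prop :=
  IsPolygonal w m ∧ ∀ (A : Plane) (j k : Fin 3),
    density m A (w j) - density m A (-w j) = density m A (w k) - density m A (-w k)

/-- `A` is a branch point: at least three of the six densities at `A` are not zero. -/
def IsBranchPoint (w : Fin 3 → Plane) (m : Measure Plane) (A : Plane) : Prop :=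
  3 ≤ {p : Fin 3 × Bool | density m A (if p.2 then w p.1 else -w p.1) ≠ 0}.ncard

/-- The vertices `r w₁`, `r (w₁ + w₂)`, `0` of the triangle, in this order. -/
def corner (w : Fin 3 → Plane) (r : ℝ) : Fin 3 → Plane :=
  ![r • w 0, r • (w 0 + w 1), 0]

/-- The closed triangle with vertices `0`, `r w₁`, `r (w₁ + w₂)`. -/
def triangle (w : Fin 3 → Plane) (r : ℝ) : Set Plane := convexHull ℝ (range (corner w r))

/-- The measures of the cone whose branch points lie in the triangle, and whose support outside
the triangle consists of finitely many half-lines `{A + t wⱼ : t > 0}` with `A` on the boundary. -/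
def MemMr (w : Fin 3 → Plane) (r : ℝ) (m : Measure Plane) : Prop :=
  MemM w m ∧ (∀ A, IsBranchPoint w m A → A ∈ triangle w r) ∧
    ∃ F : Set (Plane × Fin 3), F.Finite ∧ (∀ p ∈ F, p.1 ∈ frontier (triangle w r)) ∧
      m.support \ triangle w r = ⋃ p ∈ F, ray p.1 (w p.2)

/-- The exit points in the direction of `w j`. -/
def exitPointsIn (w : Fin 3 → Plane) (r : ℝ) (m : Measure Plane) (j : Fin 3) : Set Plane :=
  {A | A ∈ frontier (triangle w r) ∧ ray A (w j) ⊆ m.support \ triangle w r}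

/-- The attachment points: the exit points `A` such that `A` is not a corner, or `A` is a corner
and the half-line from `A` that is parallel to the opposite side is in the support. (The side
opposite to `corner w r k` is parallel to `w (k + 2)`.) -/
def attachmentPoints (w : Fin 3 → Plane) (r : ℝ) (m : Measure Plane) : Set Plane :=
  {A | (∃ j, A ∈ exitPointsIn w r m j) ∧
    (A ∉ range (corner w r) ∨ ∃ k, A = corner w r k ∧ ray A (w (k + 2)) ⊆ m.support)}

/-- The weight of a measure: the sum of its exit densities in the direction of `w₁` (for the
measures of `MemMr` it is the same in the directions of `w₂` and `w₃`). -/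
def weight (w : Fin 3 → Plane) (r : ℝ) (m : Measure Plane) : ℝ :=
  ∑ᶠ A ∈ exitPointsIn w r m 0, density m A (w 0)

/-- `A` is the point of the side from `corner w r j` to `corner w r (j + 1)` at distance
`x ∈ (0, r]` from `corner w r j`. Each boundary point has exactly one such pair `(j, x)`;
`x` is its coordinate, and the exit direction on the side `j` is `w j`. -/
def HasCoord (w : Fin 3 → Plane) (r : ℝ) (A : Plane) (j : Fin 3) (x : ℝ) : Prop :=
  x ∈ Ioc 0 r ∧ A = corner w r j + x • w (j + 1)

/-! ### Trees and their immersions -/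

/-- A binary tree with set of branch points `V`, whose edges have types in `Fin 3` such that the
types around each branch point are distinct. At each branch point `v` there is exactly one edge
of each type `j`: it leads to the branch point `u` if `nbr j v = some u`, and it is a leaf (an
edge without second endpoint) if `nbr j v = none`. -/
structure TypedTree (V : Type*) where
  nbr : Fin 3 → V → Option V
  nbr_symm : ∀ j u v, nbr j u = some v → nbr j v = some u
  nbr_irrefl : ∀ j v, nbr j v ≠ some v
  type_unique : ∀ j k u v, nbr j u = some v → nbr k u = some v → j = k
  isTree : (SimpleGraph.fromRel (fun u v => ∃ j, nbr j u = some v)).IsTree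

namespace TypedTree

variable {V : Type*} (T : TypedTree V)

/-- The parameters of the edge of type `j` at `v`: `[0, 1]` or, for a leaf, `[0, ∞)`. -/
def params (a : V × Fin 3) : Set ℝ := {t | 0 ≤ t ∧ ((T.nbr a.2 a.1).isSome → t ≤ 1)}

lemma zero_mem_params (a : V × Fin 3) : (0 : ℝ) ∈ T.params a :=
  ⟨le_rfl, fun _ => zero_le_one⟩

/-- The disjoint union of the edges; an edge between two branch points occurs twice, once
starting from each of its endpoints. -/
abbrev Pre : Type _ := Σ a : V × Fin 3, T.params a

/-- The three edges at a branch point are glued at their starting points, and the two copies of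
an edge between branch points are glued by `t ↦ 1 - t`. -/
def Glue (p q : T.Pre) : Prop :=
  (p.1.1 = q.1.1 ∧ (p.2 : ℝ) = 0 ∧ (q.2 : ℝ) = 0) ∨
  (T.nbr p.1.2 p.1.1 = some q.1.1 ∧ p.1.2 = q.1.2 ∧ (p.2 : ℝ) + q.2 = 1)

/-- The tree as a topological space (with the quotient topology). -/
abbrev Space : Type _ := Quot T.Glue

/-- The edge of type `j` at `v`, parametrized from `v`. -/
def arm (v : V) (j : Fin 3) (t : T.params (v, j)) : T.Space := Quot.mk _ ⟨(v, j), t⟩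

/-- The branch point `v` as a point of the tree. -/
def point (v : V) : T.Space := T.arm v 0 ⟨0, T.zero_mem_params _⟩

/-- Immersions of the tree: continuous maps that send each edge of type `j` between two branch
points homeomorphically onto a segment parallel to `w j` and each leaf of type `j`
homeomorphically onto a half-line parallel to `w j`. The images of the three edges at a branch
point make angles of 120 degrees, that is, they leave it in the directions `w 0, w 1, w 2` or in
the directions `-w 0, -w 1, -w 2`; this is what makes the tree measure balanced. -/
structure IsImmersion (w : Fin 3 → Plane) (f : T.Space → Plane) : Prop where
  continuous : Continuous f
  embedding : ∀ v j, IsEmbedding (f ∘ T.arm v j)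
  image : ∀ v, ∃ s : ℝ, (s = 1 ∨ s = -1) ∧ ∀ j,
    (∀ u, T.nbr j v = some u → ∃ l : ℝ, 0 < l ∧
      f (T.point u) = f (T.point v) + l • s • w j ∧
      range (f ∘ T.arm v j) = segment ℝ (f (T.point v)) (f (T.point u))) ∧
    (T.nbr j v = none →
      range (f ∘ T.arm v j) = (fun t : ℝ => f (T.point v) + t • s • w j) '' Ici 0)

/-- The tree measure: the density with respect to length is the number of preimages. -/
def treeMeasure (f : T.Space → Plane) : Measure Plane :=
  (μH[1] : Measure Plane).withDensity (fun x => ((f ⁻¹' {x}).encard : ℝ≥0∞))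

end TypedTree

end

/-!
An immersion of a tree is determined by the positions of its branch points, and moving the branch
points so that the edges keep their directions deforms the immersion
(`TypedTree.IsSigned.exists_deformation`). In the coordinates `sideForm w j`, which are constant
along `w j`, such a motion is a choice of one number for each edge, the displacement of its line,
such that the three numbers at each branch point have sum zero. On a tree this system can be solved
explicitly for all values on the leaves with sum zero: the number on an edge is up to sign the sum
over the leaves beyond it (`TypedTree.exists_extension`). Since the solution is linear in the values
on the leaves, small motions of the leaves give small motions of the branch points, and no edge
collapses (`TypedTree.IsConfined.exists_moved`).

On the other hand, everything that is asked of the measure can be read off from the leaves. All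
leaves have directions `w j` (`TypedTree.IsSigned.isConfined_of_memMr`). If the line of a leaf of
type `j` meets the side `j` of the triangle, for every leaf, then an extremal branch point shows
that all branch points lie in the triangle (`TypedTree.mem_triangle_of_leaf`). The tree measure is a
sum of length measures, one for each edge (`TypedTree.IsSigned.treeMeasure_eq`), so its densities
count edges. Its balance at a point is the sum of the signs of the branch points over that point
(`TypedTree.IsConfined.balance`), its attachment points are the points where leaves with nonzero
coordinate leave the triangle, and an exit density is the number of leaves with a given coordinate
(`TypedTree.IsConfined.mem_attachmentPoints`, `TypedTree.IsConfined.density_exit`).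

Given new attachment points, each leaf of `f` that exits at `A i` is moved so as to exit at `A' i`,
and the leaves with coordinate `0` keep this coordinate. Summation by parts over the tree shows
that the sum of the coordinates of all leaves is the weight times the size of the triangle, so the
assumption on the weighted sum says exactly that the displacements have sum zero. The same equation
excludes that an attachment point moves across a corner (`side_eq_of_close`). If the new size `r'`
of the triangle is not assumed to be close to `r`, it influences only the leaves of type `1` with
coordinate `0`; if there are any, the vanishing sum forces `r'` to be close to `r`
(`abs_le_of_sum_eq_zero`).
-/

/-! ### Coordinates adapted to the three directions -/

/-- Three unit vectors of the plane with sum zero. -/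
structure IsTriad (w : Fin 3 → Plane) : Prop where
  norm_eq : ∀ j, ‖w j‖ = 1
  sum_eq : w 0 + w 1 + w 2 = 0

lemma fin3_one_one (j : Fin 3) : j + 1 + 1 = j + 2 := by decide +revert
lemma fin3_one_two (j : Fin 3) : j + 1 + 2 = j := by decide +revert
lemma fin3_two_one (j : Fin 3) : j + 2 + 1 = j := by decide +revert
lemma fin3_two_two (j : Fin 3) : j + 2 + 2 = j + 1 := by decide +revert
lemma fin3_cases (j k : Fin 3) : k = j ∨ k = j + 1 ∨ k = j + 2 := by decide +revert
lemma fin3_sum (F : Fin 3 → ℝ) (j : Fin 3) : ∑ k, F k = F j + F (j + 1) + F (j + 2) := by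
  rw [Fin.sum_univ_three]
  fin_cases j <;> simp <;> ring

/-- The linear form that vanishes on `w j` and has the values `1` and `-1` on the other two
directions; it is constant along the lines parallel to `w j` and tells them apart. -/
noncomputable def sideForm (w : Fin 3 → Plane) (j : Fin 3) : Plane →L[ℝ] ℝ :=
  (2 / 3 : ℝ) • innerSL ℝ (w (j + 1) - w (j + 2))

lemma sideForm_apply (w : Fin 3 → Plane) (j : Fin 3) (x : Plane) :
    sideForm w j x = 2 / 3 * (inner ℝ (w (j + 1)) x - inner ℝ (w (j + 2)) x) := by
  simp [sideForm]

lemma sum_sideForm (w : Fin 3 → Plane) (x : Plane) : ∑ j, sideForm w j x = 0 := by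
  simp only [Fin.sum_univ_three, sideForm_apply]
  simp
  ring

namespace IsTriad

variable {w : Fin 3 → Plane} (hw : IsTriad w)
include hw

lemma sum_shift (j : Fin 3) : w j + w (j + 1) + w (j + 2) = 0 := by
  rw [← hw.sum_eq]
  fin_cases j <;> simp <;> abel

lemma inner_self (j : Fin 3) : inner ℝ (w j) (w j) = (1 : ℝ) := by
  rw [real_inner_self_eq_norm_sq, hw.norm_eq]; norm_num

lemma inner_succ (j : Fin 3) : inner ℝ (w j) (w (j + 1)) = (-1 / 2 : ℝ) := by
  have h : w (j + 2) = -(w j + w (j + 1)) := by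
    rw [eq_neg_iff_add_eq_zero, ← hw.sum_shift j]; abel
  have h1 := hw.inner_self (j + 2)
  rw [h, inner_neg_neg, inner_add_left, inner_add_right, inner_add_right, hw.inner_self,
    hw.inner_self, real_inner_comm (w j) (w (j + 1))] at h1
  linarith

lemma inner_succ_left (j : Fin 3) : inner ℝ (w (j + 1)) (w j) = (-1 / 2 : ℝ) := by
  rw [real_inner_comm, hw.inner_succ]

lemma sideForm_self (j : Fin 3) : sideForm w j (w j) = 0 := by
  have h2 : inner ℝ (w (j + 2)) (w j) = (-1 / 2 : ℝ) := by
    simpa [fin3_two_one] using hw.inner_succ (j + 2)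
  rw [sideForm_apply, hw.inner_succ_left, h2]; norm_num

lemma sideForm_succ (j : Fin 3) : sideForm w j (w (j + 1)) = 1 := by
  have h2 : inner ℝ (w (j + 2)) (w (j + 1)) = (-1 / 2 : ℝ) := by
    simpa [fin3_one_one] using hw.inner_succ_left (j + 1)
  rw [sideForm_apply, hw.inner_self, h2]; norm_num

lemma sideForm_succ_succ (j : Fin 3) : sideForm w j (w (j + 2)) = -1 := by
  have h2 : inner ℝ (w (j + 1)) (w (j + 2)) = (-1 / 2 : ℝ) := by
    simpa [fin3_one_one] using hw.inner_succ (j + 1)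
  rw [sideForm_apply, hw.inner_self, h2]; norm_num

lemma succ_sideForm (j : Fin 3) : sideForm w (j + 1) (w j) = -1 := by
  simpa [fin3_one_two] using hw.sideForm_succ_succ (j + 1)

lemma succ_succ_sideForm (j : Fin 3) : sideForm w (j + 2) (w j) = 1 := by
  simpa [fin3_two_one] using hw.sideForm_succ (j + 2)

lemma ne_zero (j : Fin 3) : w j ≠ 0 := by
  intro h
  have := hw.norm_eq j
  simp [h] at this

lemma eq_zero_of_sideForm {x : Plane} (h : ∀ j, sideForm w j x = 0) : x = 0 := by
  have e0 := h 0
  have e1 := h 1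
  have hs : inner ℝ (w 0 + w 1 + w 2) x = (0 : ℝ) := by rw [hw.sum_eq, inner_zero_left]
  simp only [sideForm_apply, inner_add_left, Fin.isValue, zero_add, Fin.reduceAdd] at e0 e1 hs
  have i0 : inner ℝ (w 0) x = (0 : ℝ) := by linarith
  have i1 : inner ℝ (w 1) x = (0 : ℝ) := by linarith
  have n0 := hw.inner_self 0
  have n1 := hw.inner_self 1
  have n01 := hw.inner_succ 0
  simp only [PiLp.inner_apply, Fin.sum_univ_two, RCLike.inner_apply, conj_trivial, zero_add,
    Fin.isValue] at i0 i1 n0 n1 n01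
  -- the determinant of `w 0, w 1` has square `3 / 4`
  have hdet : (w 0 0 * w 1 1 - w 0 1 * w 1 0) ^ 2 = 3 / 4 := by
    linear_combination (w 1 0 * w 1 0 + w 1 1 * w 1 1) * n0 + n1
      - (w 1 0 * w 0 0 + w 1 1 * w 0 1 - 1 / 2) * n01
  have hne : w 0 0 * w 1 1 - w 0 1 * w 1 0 ≠ 0 := by
    intro h0; rw [h0] at hdet; norm_num at hdet
  ext i
  apply mul_left_cancel₀ hne
  fin_cases i
  · simp only [Fin.zero_eta, Fin.isValue, PiLp.zero_apply]
    linear_combination w 1 1 * i0 - w 0 1 * i1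
  · simp only [Fin.mk_one, Fin.isValue, PiLp.zero_apply]
    linear_combination w 0 0 * i1 - w 1 0 * i0

lemma ext_sideForm {x y : Plane} (h : ∀ j, sideForm w j x = sideForm w j y) : x = y := by
  rw [← sub_eq_zero]
  exact hw.eq_zero_of_sideForm fun j => by rw [map_sub, h, sub_self]

lemma ext_sideForm_two {x y : Plane} (j : Fin 3) (h : sideForm w j x = sideForm w j y)
    (h' : sideForm w (j + 1) x = sideForm w (j + 1) y) : x = y := by
  have hx := sum_sideForm w x
  have hy := sum_sideForm w y
  rw [fin3_sum _ j] at hx hy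
  refine hw.ext_sideForm fun k => ?_
  rcases fin3_cases j k with rfl | rfl | rfl
  · exact h
  · exact h'
  · linarith

/-- A vector on which the form of index `j` vanishes is a multiple of `w j`. -/
lemma eq_smul_of_sideForm_eq_zero {x : Plane} {j : Fin 3} (h : sideForm w j x = 0) :
    x = (-sideForm w (j + 1) x) • w j := by
  refine hw.ext_sideForm_two j ?_ ?_
  · simp [h, hw.sideForm_self]
  · simp [hw.succ_sideForm]

lemma abs_sideForm_le (j : Fin 3) (x : Plane) : |sideForm w j x| ≤ 2 * ‖x‖ := by
  rw [sideForm_apply]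
  have h1 := abs_real_inner_le_norm (w (j + 1)) x
  have h2 := abs_real_inner_le_norm (w (j + 2)) x
  rw [hw.norm_eq, one_mul, abs_le] at h1 h2
  rw [abs_le]
  constructor <;> linarith [norm_nonneg x]

lemma norm_le_of_sideForm {x : Plane} {c : ℝ} (h : ∀ j, |sideForm w j x| ≤ c) :
    ‖x‖ ≤ 2 * c := by
  have hx : x = (-sideForm w 1 x) • w 0 + sideForm w 0 x • w 1 := by
    refine hw.ext_sideForm_two 0 ?_ ?_
    · have := hw.sideForm_self 0
      have := hw.sideForm_succ 0
      simp_all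
    · have := hw.sideForm_self 1
      have := hw.succ_sideForm 0
      simp_all
  rw [hx]
  refine (norm_add_le _ _).trans ?_
  rw [norm_smul, norm_smul, hw.norm_eq, hw.norm_eq, Real.norm_eq_abs, Real.norm_eq_abs, abs_neg]
  linarith [h 0, h 1]

lemma smul_eq_smul {c d : ℝ} {j k : Fin 3} (hc : c ≠ 0) (h : c • w j = d • w k) :
    j = k ∧ c = d := by
  have hj : j = k := by
    have e := congrArg (sideForm w k) h
    rw [map_smul, map_smul, hw.sideForm_self, smul_zero] at e
    rcases fin3_cases k j with rfl | rfl | rfl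
    · rfl
    · rw [hw.sideForm_succ] at e; simp_all
    · rw [hw.sideForm_succ_succ] at e; simp_all
  subst hj
  exact ⟨rfl, smul_left_injective ℝ (hw.ne_zero j) h⟩

end IsTriad

/-! ### The triangle -/

/-- The affine function that vanishes on the side `j + 2` of the triangle of size `r`, is constant
along `w j`, and equals the coordinate `x` on the side `j`. -/
noncomputable def sideCoord (w : Fin 3 → Plane) (r : ℝ) (j : Fin 3) (x : Plane) : ℝ :=
  sideForm w j x + if j = 1 then r else 0

lemma sum_sideCoord (w : Fin 3 → Plane) (r : ℝ) (x : Plane) : ∑ j, sideCoord w r j x = r := by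
  simp [sideCoord, Finset.sum_add_distrib, sum_sideForm]

lemma sideCoord_sum (w : Fin 3 → Plane) (r : ℝ) (j : Fin 3) (x : Plane) :
    sideCoord w r j x + sideCoord w r (j + 1) x + sideCoord w r (j + 2) x = r := by
  rw [← fin3_sum (fun k => sideCoord w r k x), sum_sideCoord]

lemma sideCoord_add (w : Fin 3 → Plane) (r : ℝ) (j : Fin 3) (x y : Plane) :
    sideCoord w r j (x + y) = sideCoord w r j x + sideForm w j y := by
  simp only [sideCoord, map_add]; ring

lemma sideCoord_sub_sideCoord (w : Fin 3 → Plane) (r : ℝ) (j : Fin 3) (x y : Plane) :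
    sideCoord w r j x - sideCoord w r j y = sideForm w j (x - y) := by
  simp only [sideCoord, map_sub]; ring

lemma convex_triangle (w : Fin 3 → Plane) (r : ℝ) : Convex ℝ (triangle w r) :=
  convex_convexHull ℝ _

lemma isClosed_triangle (w : Fin 3 → Plane) (r : ℝ) : IsClosed (triangle w r) :=
  ((Set.finite_range (corner w r)).isCompact_convexHull ℝ).isClosed

lemma mem_triangle_of_mem_frontier {w : Fin 3 → Plane} {r : ℝ} {x : Plane}
    (h : x ∈ frontier (triangle w r)) : x ∈ triangle w r :=
  (isClosed_triangle w r).frontier_subset h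

namespace IsTriad

variable {w : Fin 3 → Plane} (hw : IsTriad w)
include hw

lemma ext_sideCoord_two {r : ℝ} {x y : Plane} (j : Fin 3)
    (h : sideCoord w r j x = sideCoord w r j y)
    (h' : sideCoord w r (j + 1) x = sideCoord w r (j + 1) y) : x = y :=
  hw.ext_sideForm_two j (by simpa [sideCoord] using h) (by simpa [sideCoord] using h')

lemma sideCoord_corner (r : ℝ) (j : Fin 3) :
    sideCoord w r j (corner w r j) = 0 ∧ sideCoord w r (j + 1) (corner w r j) = 0 ∧
      sideCoord w r (j + 2) (corner w r j) = r := by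
  have a := hw.sideForm_self
  have b := hw.sideForm_succ
  have c := hw.sideForm_succ_succ
  have a0 := a 0; have a1 := a 1; have a2 := a 2
  have b0 := b 0; have b1 := b 1; have b2 := b 2
  have c0 := c 0; have c1 := c 1; have c2 := c 2
  simp only [Fin.isValue, zero_add, Fin.reduceAdd] at b0 b1 b2 c0 c1 c2
  fin_cases j <;>
    simp [sideCoord, corner, *]

lemma hasCoord_iff {r : ℝ} {A : Plane} {j : Fin 3} {x : ℝ} :
    HasCoord w r A j x ↔ 0 < x ∧ x ≤ r ∧ sideCoord w r j A = x ∧ sideCoord w r (j + 1) A = 0 := by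
  have hc := hw.sideCoord_corner r j
  constructor
  · rintro ⟨⟨h0, h1⟩, rfl⟩
    refine ⟨h0, h1, ?_, ?_⟩
    · rw [sideCoord_add, hc.1, map_smul, hw.sideForm_succ]; simp
    · rw [sideCoord_add, hc.2.1, map_smul, hw.sideForm_self]; simp
  · rintro ⟨h0, h1, h2, h3⟩
    refine ⟨⟨h0, h1⟩, hw.ext_sideCoord_two (r := r) j ?_ ?_⟩
    · rw [sideCoord_add, hc.1, map_smul, hw.sideForm_succ, h2]; simp
    · rw [sideCoord_add, hc.2.1, map_smul, hw.sideForm_self, h3]; simp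

lemma mem_triangle_iff {r : ℝ} (hr : 0 < r) {x : Plane} :
    x ∈ triangle w r ↔ ∀ j, 0 ≤ sideCoord w r j x := by
  constructor
  · intro hx j
    have hconv : Convex ℝ {y | 0 ≤ sideCoord w r j y} := by
      intro y hy z hz a b ha hb hab
      have e : sideCoord w r j (a • y + b • z)
          = a * sideCoord w r j y + b * sideCoord w r j z := by
        simp only [sideCoord, map_add, map_smul, smul_eq_mul]
        linear_combination (-(if j = 1 then r else 0)) * hab
      simp only [mem_ofPred_eq] at hy hz ⊢
      rw [e]; positivity
    refine convexHull_min ?_ hconv hx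
    rintro _ ⟨k, rfl⟩
    obtain ⟨h0, h1, h2⟩ := hw.sideCoord_corner r k
    simp only [mem_ofPred_eq]
    rcases fin3_cases k j with rfl | rfl | rfl
    · exact h0.ge
    · exact h1.ge
    · exact hr.le.trans_eq h2.symm
  · intro h
    have hx : x = ∑ k, (sideCoord w r (k + 2) x / r) • corner w r k := by
      have hs : ∀ j : Fin 3, ∑ k, (sideCoord w r (k + 2) x / r) * sideForm w j (corner w r k)
          = sideForm w j x := by
        intro j
        obtain ⟨h0, h1, h2⟩ := hw.sideCoord_corner r j
        obtain ⟨h0', h1', h2'⟩ := hw.sideCoord_corner r (j + 1)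
        obtain ⟨h0'', h1'', h2''⟩ := hw.sideCoord_corner r (j + 2)
        rw [fin3_one_one] at h1'; rw [fin3_one_two] at h2'
        rw [fin3_two_one] at h1''; rw [fin3_two_two] at h2''
        rw [fin3_sum _ j, fin3_one_two, fin3_two_two]
        have hsum := sideCoord_sum w r j x
        simp only [sideCoord] at h0 h2' h1'' hsum ⊢
        field_simp
        linear_combination (sideForm w (j + 2) x + if j + 2 = 1 then r else 0) * h0 +
          (sideForm w j x + if j = 1 then r else 0) * h2' +
          (sideForm w (j + 1) x + if j + 1 = 1 then r else 0) * h1'' -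
          (if j = 1 then r else 0) * hsum
      refine hw.ext_sideForm fun j => ?_
      rw [map_sum]
      simp only [map_smul, smul_eq_mul]
      exact (hs j).symm
    rw [hx]
    refine (convex_convexHull ℝ _).sum_mem (fun k _ => div_nonneg (h _) hr.le) ?_
      (fun k _ => subset_convexHull ℝ _ ⟨k, rfl⟩)
    rw [← Finset.sum_div, div_eq_one_iff_eq hr.ne', Fin.sum_univ_three]
    have := sideCoord_sum w r 0 x
    simp only [Fin.isValue, zero_add, Fin.reduceAdd] at this ⊢
    linarith

/-- Moving in the direction `w j` from a point where the coordinate `j + 1` is zero leaves the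
triangle. -/
lemma notMem_triangle_of_pos {r : ℝ} (hr : 0 < r) {A : Plane} {j : Fin 3}
    (hA : sideCoord w r (j + 1) A ≤ 0) {t : ℝ} (ht : 0 < t) : A + t • w j ∉ triangle w r := by
  intro h
  have := (hw.mem_triangle_iff hr).1 h (j + 1)
  rw [sideCoord_add, map_smul, hw.succ_sideForm, smul_eq_mul] at this
  linarith

lemma mem_frontier_triangle {r : ℝ} (hr : 0 < r) {A : Plane} {j : Fin 3}
    (hA : A ∈ triangle w r) (h : sideCoord w r (j + 1) A = 0) : A ∈ frontier (triangle w r) := by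
  rw [frontier, (isClosed_triangle w r).closure_eq]
  refine ⟨hA, fun hint => ?_⟩
  have hc : Tendsto (fun t : ℝ => A + t • w j) (𝓝[>] 0) (𝓝 A) := by
    have : Continuous fun t : ℝ => A + t • w j := by fun_prop
    have h1 := this.tendsto 0
    simp only [zero_smul, add_zero] at h1
    exact h1.mono_left nhdsWithin_le_nhds
  have hev := hc.eventually (mem_interior_iff_mem_nhds.1 hint)
  obtain ⟨t, ht1, ht2⟩ := (hev.and self_mem_nhdsWithin).exists
  exact hw.notMem_triangle_of_pos hr h.le ht2 ht1

end IsTriad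

/-! ### Sums of length measures of convex sets -/

/-- The set `C` contains the beginning of the half-line from `A` in the direction `v`. -/
def HasGerm (C : Set Plane) (A v : Plane) : Prop := ∃ e > 0, shortSeg A v e ⊆ C

lemma mem_shortSeg {A v : Plane} {e t : ℝ} (h0 : 0 < t) (h1 : t < e) :
    A + t • v ∈ shortSeg A v e := ⟨t, ⟨h0, h1⟩, rfl⟩

lemma shortSeg_mono (A v : Plane) {e e' : ℝ} (h : e ≤ e') : shortSeg A v e ⊆ shortSeg A v e' :=
  image_mono (Ioo_subset_Ioo_right h)

lemma HasGerm.exists_lt {C : Set Plane} {A v : Plane} (h : HasGerm C A v) {e : ℝ} (he : 0 < e) :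
    ∃ t, 0 < t ∧ t < e ∧ A + t • v ∈ C := by
  obtain ⟨d, hd, hC⟩ := h
  have : 0 < min d e := lt_min hd he
  refine ⟨min d e / 2, by linarith, ?_, hC (mem_shortSeg (by linarith) ?_)⟩
  · linarith [min_le_right d e]
  · linarith [min_le_left d e]

lemma HasGerm.mem_of_isClosed {C : Set Plane} {A v : Plane} (h : HasGerm C A v) (hC : IsClosed C)
    (hv : ‖v‖ = 1) : A ∈ C := by
  rw [← hC.closure_eq, Metric.mem_closure_iff]
  intro e he
  obtain ⟨t, h0, h1, ht⟩ := h.exists_lt he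
  refine ⟨_, ht, ?_⟩
  rwa [dist_self_add_right, norm_smul, hv, mul_one, Real.norm_of_nonneg h0.le]

lemma hausdorffMeasure_shortSeg (A : Plane) {v : Plane} (hv : ‖v‖ = 1) (e : ℝ) :
    (μH[1] : Measure Plane) (shortSeg A v e) = ENNReal.ofReal e := by
  have h : shortSeg A v e = (fun y => A + y) '' ((fun t : ℝ => t • v) '' Ioo 0 e) := by
    rw [image_image]; rfl
  rw [h, (isometry_add_left A).hausdorffMeasure_image (Or.inl zero_le_one),
    hausdorffMeasure_smul_right_image, hausdorffMeasure_real, Real.volume_Ioo, sub_zero,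
    show ‖v‖₊ = 1 from NNReal.eq hv, one_smul]

/-- A convex set either contains the beginning of a half-line or avoids it. -/
lemma germ_or_disjoint {C : Set Plane} (hC : Convex ℝ C) (A v : Plane) :
    HasGerm C A v ∨ ∃ e > 0, Disjoint C (shortSeg A v e) := by
  by_contra! h
  obtain ⟨h1, h2⟩ := h
  obtain ⟨y, hyC, t, ht, rfl⟩ := not_disjoint_iff.1 (h2 1 one_pos)
  refine h1 ⟨t, ht.1, ?_⟩
  rintro _ ⟨u, hu, rfl⟩
  obtain ⟨z, hzC, t', ht', rfl⟩ := not_disjoint_iff.1 (h2 u hu.1)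
  have hlt : 0 < t - t' := by linarith [ht'.2, hu.2]
  have : A + u • v = ((t - u) / (t - t')) • (A + t' • v) + ((u - t') / (t - t')) • (A + t • v) := by
    have e1 : (t - u) / (t - t') + (u - t') / (t - t') = 1 := by field_simp; ring
    have e2 : (t - u) / (t - t') * t' + (u - t') / (t - t') * t = u := by field_simp; ring
    calc A + u • v = ((t - u) / (t - t') + (u - t') / (t - t')) • A
          + ((t - u) / (t - t') * t' + (u - t') / (t - t') * t) • v := by rw [e1, e2, one_smul]
      _ = _ := by module
  simp only at hzC hyC ⊢
  rw [this]
  refine hC hzC hyC ?_ ?_ (by field_simp; ring)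
  · exact div_nonneg (by linarith [hu.2]) hlt.le
  · exact div_nonneg (by linarith [ht'.2]) hlt.le

section SumRestrict

variable {ι : Type*} (S : Finset ι) (C : ι → Set Plane)

open Classical in
/-- The density of a sum of length measures of convex sets counts the sets that contain the
beginning of the half-line. -/
lemma density_sum_restrict (hconv : ∀ a ∈ S, Convex ℝ (C a)) (hclosed : ∀ a ∈ S, IsClosed (C a))
    (A : Plane) {v : Plane} (hv : ‖v‖ = 1) :
    density (∑ a ∈ S, (μH[1] : Measure Plane).restrict (C a)) A v
      = ((S.filter fun a => HasGerm (C a) A v).card : ℝ) := by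
  refine Tendsto.limUnder_eq ((tendsto_const_nhds).congr' ?_)
  have key : ∀ a ∈ S, ∀ᶠ e in 𝓝[>] (0 : ℝ),
      (μH[1] : Measure Plane).restrict (C a) (shortSeg A v e)
        = ENNReal.ofReal (if HasGerm (C a) A v then e else 0) := by
    intro a ha
    by_cases hG : HasGerm (C a) A v
    · obtain ⟨e, he, hsub⟩ := hG
      filter_upwards [Ioo_mem_nhdsGT he] with e' he'
      rw [Measure.restrict_eq_self _ ((shortSeg_mono A v he'.2.le).trans hsub),
        hausdorffMeasure_shortSeg A hv, if_pos ⟨e, he, hsub⟩]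
    · obtain ⟨e, he, hdis⟩ := (germ_or_disjoint (hconv a ha) A v).resolve_left hG
      filter_upwards [Ioo_mem_nhdsGT he] with e' he'
      rw [Measure.restrict_apply' (hclosed a ha).measurableSet, inter_comm,
        (hdis.mono_right (shortSeg_mono A v he'.2.le)).inter_eq]
      simp [hG]
  have hall := (Finset.eventually_all S).2 key
  filter_upwards [hall, self_mem_nhdsWithin] with e he hpos
  have hpos' : (0 : ℝ) < e := hpos
  rw [Measure.real, Measure.finsetSum_apply, Finset.sum_congr rfl he,
    ← ENNReal.ofReal_sum_of_nonneg (fun a _ => by split_ifs <;> linarith),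
    ENNReal.toReal_ofReal (Finset.sum_nonneg fun a _ => by split_ifs <;> linarith),
    ← Finset.sum_filter, Finset.sum_const, nsmul_eq_mul, mul_div_assoc, div_self hpos'.ne', mul_one]

/-- The support of a sum of length measures of closed sets that contain the beginning of a
half-line at each of their points. -/
lemma support_sum_restrict (hclosed : ∀ a ∈ S, IsClosed (C a))
    (hgerm : ∀ a ∈ S, ∀ x ∈ C a, ∃ v : Plane, ‖v‖ = 1 ∧ HasGerm (C a) x v) :
    (∑ a ∈ S, (μH[1] : Measure Plane).restrict (C a)).support = ⋃ a ∈ S, C a := by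
  apply Subset.antisymm
  · refine Measure.support_subset_of_isClosed (isClosed_biUnion_finset hclosed) ?_
    rw [mem_ae_iff, Measure.finsetSum_apply]
    refine Finset.sum_eq_zero fun a ha => ?_
    rw [Measure.restrict_apply' (hclosed a ha).measurableSet]
    convert measure_empty (μ := (μH[1] : Measure Plane))
    rw [← disjoint_iff_inter_eq_empty, disjoint_compl_left_iff_subset]
    exact subset_biUnion_of_mem (u := C) ha
  · intro x hx
    obtain ⟨a, ha, hxa⟩ := mem_iUnion₂.1 hx
    rw [Measure.mem_support_iff_forall]
    intro U hU
    obtain ⟨v, hv, e, he, hsub⟩ := hgerm a ha x hxa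
    obtain ⟨d, hd, hball⟩ := Metric.mem_nhds_iff.1 hU
    have hpos : 0 < min d e := lt_min hd he
    have hU' : shortSeg x v (min d e) ⊆ U := by
      rintro _ ⟨t, ht, rfl⟩
      apply hball
      rw [mem_ball_iff_norm]
      simp only [add_sub_cancel_left, norm_smul, hv, mul_one, Real.norm_eq_abs, abs_of_pos ht.1]
      exact ht.2.trans_le (min_le_left _ _)
    calc 0 < ENNReal.ofReal (min d e) := ENNReal.ofReal_pos.2 hpos
      _ = (μH[1] : Measure Plane) (shortSeg x v (min d e)) :=
          (hausdorffMeasure_shortSeg x hv _).symm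
      _ = (μH[1] : Measure Plane).restrict (C a) (shortSeg x v (min d e)) :=
          (Measure.restrict_eq_self _ ((shortSeg_mono x v (min_le_right _ _)).trans hsub)).symm
      _ ≤ (μH[1] : Measure Plane).restrict (C a) U := measure_mono hU'
      _ ≤ (∑ a ∈ S, (μH[1] : Measure Plane).restrict (C a)) U := by
          rw [Measure.finsetSum_apply]
          exact Finset.single_le_sum
            (f := fun a => (μH[1] : Measure Plane).restrict (C a) U) (fun _ _ => zero_le) ha

open Classical in
lemma withDensity_card_filter (μ : Measure Plane) (hclosed : ∀ a ∈ S, IsClosed (C a)) :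
    μ.withDensity (fun x => ((S.filter fun a => x ∈ C a).card : ℝ≥0∞))
      = ∑ a ∈ S, μ.restrict (C a) := by
  ext s hs
  rw [withDensity_apply _ hs, Measure.finsetSum_apply]
  have : ∀ x, ((S.filter fun a => x ∈ C a).card : ℝ≥0∞)
      = ∑ a ∈ S, (C a).indicator (fun _ => (1 : ℝ≥0∞)) x := by
    intro x
    rw [Finset.card_filter, Nat.cast_sum]
    refine Finset.sum_congr rfl fun a _ => ?_
    by_cases h : x ∈ C a <;> simp [h]
  simp_rw [this]
  rw [lintegral_finsetSum' S fun a ha =>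
    (measurable_const.indicator (hclosed a ha).measurableSet).aemeasurable]
  refine Finset.sum_congr rfl fun a ha => ?_
  rw [lintegral_indicator_const (hclosed a ha).measurableSet, one_mul,
    Measure.restrict_apply' hs, Measure.restrict_apply hs, inter_comm]

lemma isPolygonal_sum_restrict {w : Fin 3 → Plane} (hconv : ∀ a ∈ S, Convex ℝ (C a))
    (hline : ∀ a ∈ S, ∃ (A : Plane) (j : Fin 3), C a ⊆ range (fun t : ℝ => A + t • w j)) :
    IsPolygonal w (∑ a ∈ S, (μH[1] : Measure Plane).restrict (C a)) := by
  refine ⟨S.card, fun i => C (S.equivFin.symm i), fun _ => 1, fun i => ⟨?_, ?_⟩, ?_⟩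
  · exact hconv _ (S.equivFin.symm i).2
  · exact hline _ (S.equivFin.symm i).2
  · simp only [one_smul]
    rw [← Finset.sum_coe_sort S]
    exact (Equiv.sum_comp S.equivFin.symm
      fun a : S => (μH[1] : Measure Plane).restrict (C a)).symm

end SumRestrict

/-! ### Immersed trees as sums of segments and half-lines -/

namespace TypedTree

variable {V : Type*} (T : TypedTree V)

lemma arm_zero (v : V) (j : Fin 3) (h : (0 : ℝ) ∈ T.params (v, j)) :
    T.arm v j ⟨0, h⟩ = T.point v :=
  Quot.sound (Or.inl ⟨rfl, rfl, rfl⟩)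

lemma arm_flip {v u : V} {j : Fin 3} (h : T.nbr j v = some u) {t t' : ℝ} (ht : t ∈ T.params (v, j))
    (ht' : t' ∈ T.params (u, j)) (hs : t + t' = 1) : T.arm v j ⟨t, ht⟩ = T.arm u j ⟨t', ht'⟩ :=
  Quot.sound (Or.inr ⟨h, rfl, hs⟩)

lemma le_one_of_mem_params {v u : V} {j : Fin 3} (h : T.nbr j v = some u) {t : ℝ}
    (ht : t ∈ T.params (v, j)) : t ≤ 1 := ht.2 (by simp [h])

lemma mem_params_of_nbr {v : V} {j : Fin 3} {t : ℝ} (h0 : 0 ≤ t) (h1 : t ≤ 1) :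
    t ∈ T.params (v, j) := ⟨h0, fun _ => h1⟩

lemma arm_one {v u : V} {j : Fin 3} (h : T.nbr j v = some u) (h1 : (1 : ℝ) ∈ T.params (v, j)) :
    T.arm v j ⟨1, h1⟩ = T.point u := by
  rw [T.arm_flip h h1 (T.zero_mem_params (u, j)) (by norm_num), arm_zero]

lemma exists_arm (y : T.Space) : ∃ v j t, y = T.arm v j t := by
  induction y using Quot.ind with
  | mk p => exact ⟨p.1.1, p.1.2, p.2, rfl⟩

/-- A point of the tree lies in the interior of the edge `b`. The two alternatives are the two
copies of the edge in the disjoint union that is glued to the tree. -/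
def InArm (b : V × Fin 3) : T.Space → Prop :=
  Quot.lift (fun p : T.Pre =>
      (p.1 = b ∧ (0 : ℝ) < p.2 ∧ ((T.nbr b.2 b.1).isSome → (p.2 : ℝ) < 1)) ∨
      (T.nbr p.1.2 p.1.1 = some b.1 ∧ p.1.2 = b.2 ∧ (0 : ℝ) < p.2 ∧ (p.2 : ℝ) < 1)) (by
    have key : ∀ p q : T.Pre, T.Glue p q →
        ((p.1 = b ∧ (0 : ℝ) < p.2 ∧ ((T.nbr b.2 b.1).isSome → (p.2 : ℝ) < 1)) ∨
          (T.nbr p.1.2 p.1.1 = some b.1 ∧ p.1.2 = b.2 ∧ (0 : ℝ) < p.2 ∧ (p.2 : ℝ) < 1)) →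
        ((q.1 = b ∧ (0 : ℝ) < q.2 ∧ ((T.nbr b.2 b.1).isSome → (q.2 : ℝ) < 1)) ∨
          (T.nbr q.1.2 q.1.1 = some b.1 ∧ q.1.2 = b.2 ∧ (0 : ℝ) < q.2 ∧ (q.2 : ℝ) < 1)) := by
      rintro ⟨⟨v, j⟩, t⟩ ⟨⟨u, k⟩, t'⟩ h
      obtain ⟨c, d⟩ := b
      rcases h with ⟨-, h1, -⟩ | ⟨h1, h2, h3⟩
      · simp only at h1
        simp [h1]
      · simp only at h1 h2 h3
        subst h2
        rintro (⟨h4, h5, h6⟩ | ⟨h4, h5, h6, h7⟩)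
        · simp only [Prod.mk.injEq] at h4 h5 h6 ⊢
          obtain ⟨rfl, rfl⟩ := h4
          have := h6 (by simp [h1])
          exact Or.inr ⟨T.nbr_symm _ _ _ h1, rfl, by linarith, by linarith⟩
        · simp only [Prod.mk.injEq] at h4 h5 h6 h7 ⊢
          subst h5
          rw [h1, Option.some_inj] at h4
          exact Or.inl ⟨⟨h4, rfl⟩, by linarith, fun _ => by linarith⟩
    intro p q h
    refine propext ⟨key p q h, key q p ?_⟩
    rcases h with ⟨h1, h2, h3⟩ | ⟨h1, h2, h3⟩
    · exact Or.inl ⟨h1.symm, h3, h2⟩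
    · exact Or.inr ⟨h2 ▸ T.nbr_symm _ _ _ h1, h2.symm, by linarith⟩)

/-- The tree immersed by `f` has at the branch point `v` the three directions `s v • w j`. -/
structure IsSigned (w : Fin 3 → Plane) (f : T.Space → Plane) (s : V → ℝ) : Prop where
  sign : ∀ v, s v = 1 ∨ s v = -1
  edge : ∀ v j u, T.nbr j v = some u → ∃ l : ℝ, 0 < l ∧
      f (T.point u) = f (T.point v) + l • s v • w j ∧
      range (f ∘ T.arm v j) = segment ℝ (f (T.point v)) (f (T.point u))
  leaf : ∀ v j, T.nbr j v = none →
      range (f ∘ T.arm v j) = (fun t : ℝ => f (T.point v) + t • s v • w j) '' Ici 0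

variable {T} {w : Fin 3 → Plane} {f : T.Space → Plane}

lemma IsImmersion.exists_isSigned (hf : T.IsImmersion w f) : ∃ s, T.IsSigned w f s := by
  choose s hs using hf.image
  exact ⟨s, fun v => (hs v).1, fun v j => ((hs v).2 j).1, fun v j => ((hs v).2 j).2⟩

namespace IsSigned

variable {s : V → ℝ} (hs : T.IsSigned w f s)
include hs

lemma ne_zero (v : V) : s v ≠ 0 := by
  rcases hs.sign v with h | h <;> rw [h] <;> norm_num

lemma eq_neg (hw : IsTriad w) {v u : V} {j : Fin 3} (h : T.nbr j v = some u) : s u = -s v := by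
  obtain ⟨l, hl, e, -⟩ := hs.edge v j u h
  obtain ⟨l', hl', e', -⟩ := hs.edge u j v (T.nbr_symm _ _ _ h)
  have : (l * s v + l' * s u) • w j = 0 := by
    rw [e, add_assoc, left_eq_add] at e'
    rw [← e']; module
  have h0 := (smul_eq_zero.1 this).resolve_right (hw.ne_zero j)
  rcases hs.sign v with h1 | h1 <;> rcases hs.sign u with h2 | h2 <;> rw [h1, h2] at h0 ⊢ <;>
    linarith

lemma norm_smul_eq_one (hw : IsTriad w) (v : V) (j : Fin 3) : ‖s v • w j‖ = 1 := by
  rw [norm_smul, hw.norm_eq]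
  rcases hs.sign v with h | h <;> rw [h] <;> norm_num

end IsSigned

/-- The image of the edge of type `a.2` at `a.1`. -/
def piece (T : TypedTree V) (f : T.Space → Plane) (a : V × Fin 3) : Set Plane :=
  range (f ∘ T.arm a.1 a.2)

lemma piece_flip {v u : V} {j : Fin 3} (h : T.nbr j v = some u) :
    T.piece f (v, j) = T.piece f (u, j) := by
  have key : ∀ {v u : V}, T.nbr j v = some u → T.piece f (v, j) ⊆ T.piece f (u, j) := by
    rintro v u h _ ⟨⟨t, ht⟩, rfl⟩
    have h1 := T.le_one_of_mem_params h ht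
    have h0 := ht.1
    exact ⟨⟨1 - t, T.mem_params_of_nbr (by linarith) (by linarith)⟩,
      congrArg f (T.arm_flip h ht _ (by ring)).symm⟩
  exact (key h).antisymm (key (T.nbr_symm _ _ _ h))

open Classical in
/-- Every edge is counted once: the leaves, and each edge between two branch points from its
endpoint with sign `1`. -/
noncomputable def edges (T : TypedTree V) [Fintype V] (s : V → ℝ) : Finset (V × Fin 3) :=
  Finset.univ.filter fun a => T.nbr a.2 a.1 = none ∨ s a.1 = 1

lemma mem_edges [Fintype V] {s : V → ℝ} {a : V × Fin 3} :
    a ∈ T.edges s ↔ T.nbr a.2 a.1 = none ∨ s a.1 = 1 := by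
  simp [edges]

namespace IsSigned

variable {s : V → ℝ} (hs : T.IsSigned w f s)
include hs

lemma exists_mem_edges [Fintype V] (hw : IsTriad w) (v : V) (j : Fin 3) :
    (v, j) ∈ T.edges s ∨ ∃ u, T.nbr j v = some u ∧ (u, j) ∈ T.edges s := by
  simp only [mem_edges]
  rcases h : T.nbr j v with _ | u
  · simp
  · rcases hs.sign v with h1 | h1
    · exact Or.inl (Or.inr h1)
    · exact Or.inr ⟨u, rfl, Or.inr (by rw [hs.eq_neg hw h, h1]; norm_num)⟩

lemma exists_mem_edges_piece [Fintype V] (hw : IsTriad w) (v : V) (j : Fin 3) :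
    ∃ a ∈ T.edges s, a.2 = j ∧ T.piece f a = T.piece f (v, j) := by
  rcases hs.exists_mem_edges hw v j with h | ⟨u, hu, h⟩
  · exact ⟨_, h, rfl, rfl⟩
  · exact ⟨_, h, rfl, (piece_flip hu).symm⟩

lemma inArm_unique [Fintype V] (hw : IsTriad w) {a b : V × Fin 3} (ha : a ∈ T.edges s)
    (hb : b ∈ T.edges s) {t : T.params a} (h : T.InArm b (T.arm a.1 a.2 t)) : a = b := by
  rcases h with h | ⟨h1, h2, -, -⟩
  · exact h.1
  · simp only at h1 h2
    have h3 := T.nbr_symm _ _ _ h1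
    rw [mem_edges] at ha hb
    rw [h2] at h3
    have ha' := ha.resolve_left (by simp [h1])
    have hb' := hb.resolve_left (by simp [h3])
    have := hs.eq_neg hw h1
    rw [ha', hb'] at this
    norm_num at this

open Classical in
/-- Away from the images of the branch points, the preimages correspond to the edges whose image
contains the point. -/
lemma encard_preimage [Fintype V] (hw : IsTriad w) (hf : T.IsImmersion w f) {x : Plane}
    (hx : x ∉ range fun v => f (T.point v)) :
    (f ⁻¹' {x}).encard = (((T.edges s).filter fun a => x ∈ T.piece f a).card : ℕ∞) := by
  have hex : ∀ a : V × Fin 3, ∃ y : T.Space, x ∈ T.piece f a →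
      f y = x ∧ ∃ t, y = T.arm a.1 a.2 t := by
    intro a
    by_cases h : x ∈ T.piece f a
    · obtain ⟨t, ht⟩ := h
      exact ⟨T.arm a.1 a.2 t, fun _ => ⟨ht, t, rfl⟩⟩
    · exact ⟨T.point a.1, fun h' => (h h').elim⟩
  choose h hh using hex
  -- a preimage is not an endpoint of its edge
  have hpos : ∀ v j (t : T.params (v, j)), f (T.arm v j t) = x →
      (0 : ℝ) < t ∧ ((T.nbr j v).isSome → (t : ℝ) < 1) := by
    intro v j t ht
    constructor
    · refine lt_of_le_of_ne t.2.1 fun h0 => hx ⟨v, ?_⟩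
      rw [← ht]
      exact congrArg f ((T.arm_zero v j (T.zero_mem_params _)).symm.trans
        (congrArg _ (Subtype.ext h0)))
    · intro hsome
      obtain ⟨u, hu⟩ := Option.isSome_iff_exists.1 hsome
      refine lt_of_le_of_ne (t.2.2 hsome) fun h1 => hx ⟨u, ?_⟩
      rw [← ht]
      exact congrArg f ((T.arm_one hu (h1 ▸ t.2)).symm.trans (congrArg _ (Subtype.ext h1.symm)))
  have himg : f ⁻¹' {x} = h '' ((T.edges s).filter fun a => x ∈ T.piece f a : Set (V × Fin 3)) := by
    have harm : ∀ v j (t : T.params (v, j)), f (T.arm v j t) = x → (v, j) ∈ T.edges s →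
        T.arm v j t ∈ h '' ((T.edges s).filter fun a => x ∈ T.piece f a : Set (V × Fin 3)) := by
      intro v j t ht hmem
      have hp : x ∈ T.piece f (v, j) := ⟨t, ht⟩
      refine ⟨(v, j), by simp [hmem, hp], ?_⟩
      obtain ⟨h1, t', h2⟩ := hh _ hp
      rw [h2] at h1 ⊢
      exact congrArg _ ((hf.embedding v j).injective (h1.trans ht.symm))
    ext y
    constructor
    · intro hy
      obtain ⟨v, j, t, rfl⟩ := T.exists_arm y
      rcases hs.exists_mem_edges hw v j with hmem | ⟨u, hu, hmem⟩
      · exact harm v j t hy hmem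
      · have h0 := t.2.1
        have h1 := T.le_one_of_mem_params hu t.2
        have e : T.arm v j t = T.arm u j ⟨1 - t, T.mem_params_of_nbr (by linarith) (by linarith)⟩ :=
          T.arm_flip hu t.2 _ (by ring)
        have hy' : f (T.arm v j t) = x := hy
        rw [e] at hy' ⊢
        exact harm u j _ hy' hmem
    · rintro ⟨a, ha, rfl⟩
      simp only [Finset.coe_filter, mem_ofPred_eq] at ha
      exact (hh a ha.2).1
  have hinj : InjOn h ((T.edges s).filter fun a => x ∈ T.piece f a : Set (V × Fin 3)) := by
    intro a ha b hb hab
    simp only [Finset.coe_filter, mem_ofPred_eq] at ha hb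
    obtain ⟨h1, t, ht⟩ := hh a ha.2
    obtain ⟨h2, t', ht'⟩ := hh b hb.2
    have hb' : T.InArm b (T.arm b.1 b.2 t') :=
      Or.inl ⟨rfl, hpos b.1 b.2 t' (by rw [← ht', h2])⟩
    rw [← ht', ← hab, ht] at hb'
    exact hs.inArm_unique hw ha.1 hb.1 hb'
  rw [himg, hinj.encard_image, Set.encard_coe_eq_coe_finsetCard]

lemma edge_piece {v u : V} {j : Fin 3} (h : T.nbr j v = some u) :
    T.piece f (v, j) = segment ℝ (f (T.point v)) (f (T.point u)) :=
  (hs.edge v j u h).choose_spec.2.2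

lemma leaf_piece {v : V} {j : Fin 3} (h : T.nbr j v = none) :
    T.piece f (v, j) = (fun t : ℝ => f (T.point v) + t • s v • w j) '' Ici 0 :=
  hs.leaf v j h

lemma convex_piece (a : V × Fin 3) : Convex ℝ (T.piece f a) := by
  obtain ⟨v, j⟩ := a
  rcases h : T.nbr j v with _ | u
  · rw [hs.leaf_piece h]
    have : (fun t : ℝ => f (T.point v) + t • s v • w j)
        = AffineMap.lineMap (f (T.point v)) (f (T.point v) + s v • w j) := by
      ext1 t; simp [AffineMap.lineMap_apply, add_comm]
    rw [this]
    exact (convex_Ici 0).affine_image _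
  · rw [hs.edge_piece h]
    exact convex_segment _ _

lemma isClosed_piece (hw : IsTriad w) (a : V × Fin 3) : IsClosed (T.piece f a) := by
  obtain ⟨v, j⟩ := a
  rcases h : T.nbr j v with _ | u
  · rw [hs.leaf_piece h]
    have hiso : Isometry fun t : ℝ => f (T.point v) + t • s v • w j := by
      refine Isometry.of_dist_eq fun t t' => ?_
      rw [dist_add_left, dist_eq_norm, ← sub_smul, norm_smul, hs.norm_smul_eq_one hw, mul_one,
        Real.dist_eq, Real.norm_eq_abs]
    exact hiso.isClosedEmbedding.isClosedMap _ isClosed_Ici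
  · rw [hs.edge_piece h, segment_eq_image_lineMap]
    exact (isCompact_Icc.image (AffineMap.lineMap_continuous)).isClosed

/-- The images of the branch points are a null set, and elsewhere the number of preimages is the
number of edges over a point. -/
lemma treeMeasure_eq [Fintype V] (hw : IsTriad w) (hf : T.IsImmersion w f) :
    T.treeMeasure f = ∑ a ∈ T.edges s, (μH[1] : Measure Plane).restrict (T.piece f a) := by
  classical
  rw [← withDensity_card_filter _ _ _ fun a _ => hs.isClosed_piece hw a]
  refine withDensity_congr_ae ?_
  have hnull : (μH[1] : Measure Plane) (range fun v => f (T.point v)) = 0 := by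
    have := Measure.nullSingletonClass_hausdorff Plane one_pos
    exact (Set.finite_range _).measure_zero _
  filter_upwards [measure_eq_zero_iff_ae_notMem.1 hnull] with x hx
  rw [hs.encard_preimage hw hf hx]
  simp

end IsSigned

end TypedTree

/-! ### Germs of segments and half-lines -/

lemma germ_image_iff {B A d : Plane} (hd : d ≠ 0) (J : Set ℝ) :
    HasGerm ((fun t : ℝ => B + t • d) '' J) A d ↔
      ∃ t, A = B + t • d ∧ ∃ e > 0, Ioo t (t + e) ⊆ J := by
  constructor
  · rintro ⟨e, he, h⟩
    obtain ⟨t', -, ht'⟩ := h (mem_shortSeg (half_pos he) (half_lt_self he))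
    refine ⟨t' - e / 2, ?_, e, he, ?_⟩
    · rw [← sub_eq_zero] at ht' ⊢
      rw [← neg_eq_zero, ← ht']
      module
    · intro u hu
      obtain ⟨t'', ht'', h2⟩ := h (mem_shortSeg (t := u - (t' - e / 2)) (by linarith [hu.1])
        (by linarith [hu.2]))
      have : (t'' - u) • d = 0 := by
        have := congrArg₂ (· - ·) h2 ht'
        simp only at this
        rw [← sub_eq_zero] at this
        rw [← this]; module
      have := (smul_eq_zero.1 this).resolve_right hd
      rwa [← sub_eq_zero.1 this]
  · rintro ⟨t, rfl, e, he, h⟩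
    refine ⟨e, he, ?_⟩
    rintro _ ⟨u, hu, rfl⟩
    exact ⟨t + u, h ⟨by linarith [hu.1], by linarith [hu.2]⟩, by module⟩

lemma germ_image_neg_iff {B A d : Plane} (hd : d ≠ 0) (J : Set ℝ) :
    HasGerm ((fun t : ℝ => B + t • d) '' J) A (-d) ↔
      ∃ t, A = B + t • d ∧ ∃ e > 0, Ioo (t - e) t ⊆ J := by
  have h : (fun t : ℝ => B + t • d) '' J = (fun t : ℝ => B + t • (-d)) '' (Neg.neg '' J) := by
    rw [image_image]; simp
  rw [h, germ_image_iff (neg_ne_zero.2 hd)]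
  constructor
  · rintro ⟨t, rfl, e, he, hJ⟩
    refine ⟨-t, by simp, e, he, fun u hu => ?_⟩
    obtain ⟨y, hy, hyu⟩ :=
      hJ (show -u ∈ Ioo t (t + e) from ⟨by linarith [hu.2], by linarith [hu.1]⟩)
    rwa [← neg_injective hyu]
  · rintro ⟨t, rfl, e, he, hJ⟩
    refine ⟨-t, by simp, e, he, fun u hu => ⟨-u, hJ ⟨by linarith [hu.2], by linarith [hu.1]⟩, ?_⟩⟩
    simp

lemma exists_Ioo_subset_Icc {t l : ℝ} :
    (∃ e > 0, Ioo t (t + e) ⊆ Icc 0 l) ↔ 0 ≤ t ∧ t < l := by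
  constructor
  · rintro ⟨e, he, h⟩
    obtain ⟨h1, h2⟩ := (Icc_subset_Icc_iff (by linarith)).1
      (closure_Ioo (show t ≠ t + e by linarith) ▸ closure_minimal h isClosed_Icc)
    exact ⟨h1, by linarith⟩
  · rintro ⟨h0, h1⟩
    exact ⟨l - t, by linarith, fun u hu => ⟨by linarith [hu.1], by linarith [hu.2]⟩⟩

lemma exists_Ioo_subset_Icc' {t l : ℝ} :
    (∃ e > 0, Ioo (t - e) t ⊆ Icc 0 l) ↔ 0 < t ∧ t ≤ l := by
  constructor
  · rintro ⟨e, he, h⟩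
    obtain ⟨h1, h2⟩ := (Icc_subset_Icc_iff (by linarith)).1
      (closure_Ioo (show t - e ≠ t by linarith) ▸ closure_minimal h isClosed_Icc)
    exact ⟨by linarith, h2⟩
  · rintro ⟨h0, h1⟩
    exact ⟨t, by linarith, fun u hu => ⟨by linarith [hu.1], by linarith [hu.2]⟩⟩

lemma exists_Ioo_subset_Ici {t : ℝ} : (∃ e > 0, Ioo t (t + e) ⊆ Ici 0) ↔ 0 ≤ t := by
  constructor
  · rintro ⟨e, he, h⟩
    exact (Icc_subset_Ici_iff (by linarith)).1
      (closure_Ioo (show t ≠ t + e by linarith) ▸ closure_minimal h isClosed_Ici)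
  · exact fun h0 => ⟨1, one_pos, fun u hu => h0.trans hu.1.le⟩

lemma exists_Ioo_subset_Ici' {t : ℝ} : (∃ e > 0, Ioo (t - e) t ⊆ Ici 0) ↔ 0 < t := by
  constructor
  · rintro ⟨e, he, h⟩
    have := (Icc_subset_Ici_iff (by linarith)).1
      (closure_Ioo (show t - e ≠ t by linarith) ▸ closure_minimal h isClosed_Ici)
    linarith
  · exact fun h0 => ⟨t, h0, fun u hu => by simpa using hu.1.le⟩

/-- If all points `A + n • v` lie in a finite union, infinitely many of them lie in one of its
members. -/
lemma exists_frequently_of_finite {α : Type*} {F : Set α} (hF : F.Finite) {P : α → ℕ → Prop}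
    (h : ∀ n, ∃ a ∈ F, P a n) : ∃ a ∈ F, ∃ᶠ n in atTop, P a n := by
  by_contra! hcon
  obtain ⟨n, hn⟩ := ((eventually_all_finite hF).2 hcon).exists
  obtain ⟨a, ha, hP⟩ := h n
  exact hn a ha hP

/-- If a half-line parallel to `w j` passes infinitely many times through a half-line in the
direction `w k`, then both are on the same line. -/
lemma IsTriad.of_frequently_mem_ray {w : Fin 3 → Plane} (hw : IsTriad w) {A P : Plane} {c : ℝ}
    (hc : c ≠ 0) {j k : Fin 3} (h : ∃ᶠ n : ℕ in atTop, A + ((n : ℝ) * c) • w j ∈ ray P (w k)) :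
    j = k ∧ sideForm w j A = sideForm w j P := by
  obtain ⟨n, -, t, ht, h1⟩ := frequently_atTop.1 h 0
  obtain ⟨m, hm, t', ht', h2⟩ := frequently_atTop.1 h (n + 1)
  have hmn : (n : ℝ) < m := by exact_mod_cast hm
  simp only at h1 h2
  have e : (((m : ℝ) - n) * c) • w j = (t' - t) • w k := by
    have : (((m : ℝ) - n) * c) • w j = (A + ((m : ℝ) * c) • w j) - (A + ((n : ℝ) * c) • w j) := by
      module
    rw [this, ← h1, ← h2]; module
  obtain ⟨rfl, -⟩ := hw.smul_eq_smul (mul_ne_zero (sub_pos.2 hmn).ne' hc) e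
  refine ⟨rfl, ?_⟩
  have := congrArg (sideForm w j) h1
  simpa [hw.sideForm_self] using this.symm

/-! ### Balance and summation over the tree -/

namespace TypedTree

variable {V : Type*} {T : TypedTree V} {w : Fin 3 → Plane} {f : T.Space → Plane} {s : V → ℝ}

/-- The other endpoint of the edge of type `j` at `v`, and `v` itself if this edge is a leaf. -/
def partner (T : TypedTree V) (j : Fin 3) (v : V) : V := (T.nbr j v).getD v

lemma partner_of_some {j : Fin 3} {v u : V} (h : T.nbr j v = some u) : T.partner j v = u := by
  simp [partner, h]

lemma partner_of_none {j : Fin 3} {v : V} (h : T.nbr j v = none) : T.partner j v = v := by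
  simp [partner, h]

lemma partner_involutive (T : TypedTree V) (j : Fin 3) : Function.Involutive (T.partner j) := by
  intro v
  rcases h : T.nbr j v with _ | u
  · rw [partner_of_none h, partner_of_none h]
  · rw [partner_of_some h, partner_of_some (T.nbr_symm _ _ _ h)]

lemma sum_partner (T : TypedTree V) [Fintype V] (j : Fin 3) (H : V → ℝ) :
    ∑ v, H (T.partner j v) = ∑ v, H v :=
  Equiv.sum_comp (T.partner_involutive j).toPerm H

lemma nbr_partner_eq_none_iff {j : Fin 3} {v : V} :
    T.nbr j (T.partner j v) = none ↔ T.nbr j v = none := by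
  rcases h : T.nbr j v with _ | u
  · rw [partner_of_none h, h]
  · rw [partner_of_some h, T.nbr_symm _ _ _ h]; simp

namespace IsSigned

variable (hs : T.IsSigned w f s)
include hs

lemma exists_edge_piece_eq_image {v u : V} {j : Fin 3} (h : T.nbr j v = some u) :
    ∃ l : ℝ, 0 < l ∧ f (T.point u) = f (T.point v) + l • s v • w j ∧
      T.piece f (v, j) = (fun t : ℝ => f (T.point v) + t • s v • w j) '' Icc 0 l := by
  obtain ⟨l, hl, he, -⟩ := hs.edge v j u h
  refine ⟨l, hl, he, ?_⟩
  rw [hs.edge_piece h, segment_eq_image', he]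
  ext x
  constructor
  · rintro ⟨t, ht, rfl⟩
    refine ⟨t * l, ⟨mul_nonneg ht.1 hl.le, mul_le_of_le_one_left hl.le ht.2⟩, ?_⟩
    simp only; module
  · rintro ⟨t, ht, rfl⟩
    refine ⟨t / l, ⟨div_nonneg ht.1 hl.le, div_le_one_of_le₀ ht.2 hl.le⟩, ?_⟩
    have : (t / l) * l = t := by field_simp
    simp only
    rw [add_sub_cancel_left, smul_smul, this]

lemma exists_piece_eq_image (v : V) (j : Fin 3) :
    ∃ J : Set ℝ, T.piece f (v, j) = (fun t : ℝ => f (T.point v) + t • s v • w j) '' J := by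
  rcases h : T.nbr j v with _ | u
  · exact ⟨Ici 0, hs.leaf_piece h⟩
  · obtain ⟨l, hl, -, e⟩ := hs.exists_edge_piece_eq_image h
    exact ⟨Icc 0 l, e⟩

lemma piece_subset_line (v : V) (j : Fin 3) :
    T.piece f (v, j) ⊆ range fun t : ℝ => f (T.point v) + t • w j := by
  obtain ⟨J, e⟩ := hs.exists_piece_eq_image v j
  rw [e]
  rintro _ ⟨t, -, rfl⟩
  exact ⟨t * s v, by simp only; module⟩

lemma sideForm_eq_of_mem_piece (hw : IsTriad w) {v : V} {j : Fin 3} {x : Plane}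
    (hx : x ∈ T.piece f (v, j)) : sideForm w j x = sideForm w j (f (T.point v)) := by
  obtain ⟨t, rfl⟩ := hs.piece_subset_line v j hx
  simp [hw.sideForm_self]

lemma germ_piece (hw : IsTriad w) (v : V) (j : Fin 3) :
    HasGerm (T.piece f (v, j)) (f (T.point v)) (s v • w j) := by
  have hd : s v • w j ≠ 0 := smul_ne_zero (hs.ne_zero v) (hw.ne_zero j)
  rcases h : T.nbr j v with _ | u
  · rw [hs.leaf_piece h, germ_image_iff hd]
    exact ⟨0, by simp, exists_Ioo_subset_Ici.2 le_rfl⟩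
  · obtain ⟨l, hl, -, e⟩ := hs.exists_edge_piece_eq_image h
    rw [e, germ_image_iff hd]
    exact ⟨0, by simp, exists_Ioo_subset_Icc.2 ⟨le_rfl, hl⟩⟩

lemma exists_germ_of_mem_piece (hw : IsTriad w) {a : V × Fin 3} {x : Plane}
    (hx : x ∈ T.piece f a) : ∃ v : Plane, ‖v‖ = 1 ∧ HasGerm (T.piece f a) x v := by
  obtain ⟨v, j⟩ := a
  have hd : s v • w j ≠ 0 := smul_ne_zero (hs.ne_zero v) (hw.ne_zero j)
  have hn := hs.norm_smul_eq_one hw v j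
  rcases h : T.nbr j v with _ | u
  · rw [hs.leaf_piece h] at hx ⊢
    obtain ⟨t, ht, rfl⟩ := hx
    exact ⟨_, hn, (germ_image_iff hd _).2 ⟨t, rfl, exists_Ioo_subset_Ici.2 ht⟩⟩
  · obtain ⟨l, hl, -, e⟩ := hs.exists_edge_piece_eq_image h
    rw [e] at hx ⊢
    obtain ⟨t, ht, rfl⟩ := hx
    rcases ht.2.lt_or_eq with h1 | h1
    · exact ⟨_, hn, (germ_image_iff hd _).2 ⟨t, rfl, exists_Ioo_subset_Icc.2 ⟨ht.1, h1⟩⟩⟩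
    · exact ⟨_, (norm_neg _).trans hn,
        (germ_image_neg_iff hd _).2 ⟨t, rfl, exists_Ioo_subset_Icc'.2 ⟨h1 ▸ hl, ht.2⟩⟩⟩

lemma eq_of_germ_piece (hw : IsTriad w) {v : V} {j k : Fin 3} {A : Plane} {c : ℝ} (hc : c ≠ 0)
    (h : HasGerm (T.piece f (v, j)) A (c • w k)) : k = j := by
  obtain ⟨t, ht, -, h1⟩ := h.exists_lt one_pos
  obtain ⟨t', ht', hlt, h2⟩ := h.exists_lt ht
  have e := (hs.sideForm_eq_of_mem_piece hw h1).trans (hs.sideForm_eq_of_mem_piece hw h2).symm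
  simp only [map_add, map_smul, smul_eq_mul, add_right_inj] at e
  have h0 : sideForm w j (w k) = 0 := by
    by_contra hne
    have := mul_right_cancel₀ (mul_ne_zero hc hne) e
    linarith
  rcases fin3_cases j k with rfl | rfl | rfl
  · rfl
  · rw [hw.sideForm_succ] at h0; norm_num at h0
  · rw [hw.sideForm_succ_succ] at h0; norm_num at h0

open Classical in
/-- An edge that starts at a branch point with sign `1` contributes to the balance at its
endpoints only. -/
lemma germ_sub_germ (hw : IsTriad w) {v : V} (j : Fin 3) (hv : s v = 1) (A : Plane) :
    ((if HasGerm (T.piece f (v, j)) A (w j) then 1 else 0 : ℝ)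
        - if HasGerm (T.piece f (v, j)) A (-w j) then 1 else 0)
      = (if f (T.point v) = A then 1 else 0)
        - if T.nbr j v ≠ none ∧ f (T.point (T.partner j v)) = A then 1 else 0 := by
  have hd := hw.ne_zero j
  have hinj : ∀ t t' : ℝ, f (T.point v) + t • w j = f (T.point v) + t' • w j ↔ t = t' := by
    intro t t'
    rw [add_right_inj]
    exact (smul_left_injective ℝ hd).eq_iff
  have hinj0 : ∀ t : ℝ, f (T.point v) = f (T.point v) + t • w j ↔ t = 0 := by
    intro t
    simp [hd]
  rcases h : T.nbr j v with _ | u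
  · rw [hs.leaf_piece h, hv]
    simp only [one_smul, germ_image_iff hd, germ_image_neg_iff hd, exists_Ioo_subset_Ici,
      exists_Ioo_subset_Ici', ne_eq, not_true_eq_false, false_and, if_false, sub_zero]
    by_cases hA : ∃ t : ℝ, A = f (T.point v) + t • w j
    · obtain ⟨t, rfl⟩ := hA
      simp only [hinj, hinj0, exists_eq_left']
      rcases lt_trichotomy t 0 with h1 | h1 | h1
      · simp [h1.not_ge, h1.not_gt, h1.ne]
      · simp [h1]
      · simp [h1, h1.le, h1.ne']
    · have hA' : f (T.point v) ≠ A := fun e => hA ⟨0, by simp [e]⟩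
      push Not at hA
      simp [hA, hA']
  · obtain ⟨l, hl, he, e⟩ := hs.exists_edge_piece_eq_image h
    rw [e, partner_of_some h, he, hv]
    simp only [one_smul, germ_image_iff hd, germ_image_neg_iff hd, exists_Ioo_subset_Icc,
      exists_Ioo_subset_Icc', ne_eq, reduceCtorEq, not_false_eq_true, true_and]
    by_cases hA : ∃ t : ℝ, A = f (T.point v) + t • w j
    · obtain ⟨t, rfl⟩ := hA
      simp only [hinj, hinj0, exists_eq_left']
      split_ifs <;> first | (norm_num; done) | (exfalso; grind)
    · have hA' : f (T.point v) ≠ A := fun e => hA ⟨0, by simp [e]⟩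
      push Not at hA
      have hA'' : ∀ t : ℝ, f (T.point v) + t • w j ≠ A := fun t => (hA t).symm
      simp [hA, hA', hA'']

end IsSigned

/-- The immersion `f` has signs `s`, its leaves have directions `w j`, and its branch points lie
in the triangle of size `r`. -/
structure IsConfined (T : TypedTree V) (w : Fin 3 → Plane) (f : T.Space → Plane) (s : V → ℝ)
    (r : ℝ) : Prop extends T.IsSigned w f s where
  leaf_sign : ∀ v j, T.nbr j v = none → s v = 1
  mem_triangle : ∀ v, f (T.point v) ∈ triangle w r

open Classical in
/-- If a function of the branch points has equal values at the endpoints of every edge of type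
`j`, then the edges between branch points cancel in the signed sum. -/
lemma sum_sign_mul [Fintype V] (j : Fin 3)
    (hneg : ∀ v u, T.nbr j v = some u → s u = -s v) (hleaf : ∀ v, T.nbr j v = none → s v = 1)
    (F : V → ℝ) (hF : ∀ v u, T.nbr j v = some u → F v = F u) :
    ∑ v, s v * F v = ∑ v, if T.nbr j v = none then F v else 0 := by
  have h : ∑ v, (if T.nbr j v = none then 0 else s v * F v) = 0 := by
    have h1 := T.sum_partner j fun v => if T.nbr j v = none then 0 else s v * F v
    have h2 : ∀ v, (if T.nbr j (T.partner j v) = none then 0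
        else s (T.partner j v) * F (T.partner j v))
        = -(if T.nbr j v = none then 0 else s v * F v) := by
      intro v
      simp only [nbr_partner_eq_none_iff]
      split_ifs with h
      · simp
      · obtain ⟨u, hu⟩ := Option.ne_none_iff_exists'.1 h
        rw [partner_of_some hu, hneg v u hu, hF v u hu]; ring
    simp only [h2, Finset.sum_neg_distrib] at h1
    linarith
  have h' : ∀ v, s v * F v = (if T.nbr j v = none then F v else 0)
      + if T.nbr j v = none then 0 else s v * F v := by
    intro v
    split_ifs with h
    · rw [hleaf v h]; ring
    · ring
  rw [Finset.sum_congr rfl fun v _ => h' v, Finset.sum_add_distrib, h, add_zero]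

end TypedTree

/-! ### The measure of a tree confined to a triangle -/

namespace TypedTree

variable {V : Type*} {T : TypedTree V} {w : Fin 3 → Plane} {f : T.Space → Plane} {s : V → ℝ}

namespace IsSigned

variable (hs : T.IsSigned w f s)
include hs

open Classical in
lemma density_eq [Fintype V] (hw : IsTriad w) (hf : T.IsImmersion w f) (A : Plane) {v : Plane}
    (hv : ‖v‖ = 1) : density (T.treeMeasure f) A v
      = (((T.edges s).filter fun a => HasGerm (T.piece f a) A v).card : ℝ) := by
  rw [hs.treeMeasure_eq hw hf]
  exact density_sum_restrict _ _ (fun a _ => hs.convex_piece a)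
    (fun a _ => hs.isClosed_piece hw a) A hv

lemma isPolygonal_treeMeasure [Fintype V] (hw : IsTriad w) (hf : T.IsImmersion w f) :
    IsPolygonal w (T.treeMeasure f) := by
  rw [hs.treeMeasure_eq hw hf]
  exact isPolygonal_sum_restrict _ _ (fun a _ => hs.convex_piece a)
    (fun a _ => ⟨_, a.2, hs.piece_subset_line a.1 a.2⟩)

lemma support_eq [Fintype V] (hw : IsTriad w) (hf : T.IsImmersion w f) :
    (T.treeMeasure f).support = ⋃ a, T.piece f a := by
  rw [hs.treeMeasure_eq hw hf, support_sum_restrict _ _ (fun a _ => hs.isClosed_piece hw a)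
    (fun a _ x hx => hs.exists_germ_of_mem_piece hw hx)]
  refine (iUnion₂_subset fun a _ => subset_iUnion _ a).antisymm (iUnion_subset fun a => ?_)
  obtain ⟨b, hb, -, e⟩ := hs.exists_mem_edges_piece hw a.1 a.2
  exact e.symm.subset.trans (subset_biUnion_of_mem (u := T.piece f) hb)

lemma isBranchPoint_point [Fintype V] (hw : IsTriad w) (hf : T.IsImmersion w f) (v : V) :
    IsBranchPoint w (T.treeMeasure f) (f (T.point v)) := by
  classical
  have hdir : ∀ j, (if s v = 1 then w j else -w j) = s v • w j := by
    intro j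
    rcases hs.sign v with h | h <;> norm_num [h]
  have hsub : range (fun j : Fin 3 => (j, decide (s v = 1))) ⊆
      {p : Fin 3 × Bool |
        density (T.treeMeasure f) (f (T.point v)) (if p.2 then w p.1 else -w p.1) ≠ 0} := by
    rintro _ ⟨j, rfl⟩
    simp only [mem_ofPred_eq, decide_eq_true_eq]
    rw [hdir, hs.density_eq hw hf _ (hs.norm_smul_eq_one hw v j), Nat.cast_ne_zero,
      Finset.card_ne_zero]
    obtain ⟨a, ha, -, e⟩ := hs.exists_mem_edges_piece hw v j
    exact ⟨a, Finset.mem_filter.2 ⟨ha, e ▸ hs.germ_piece hw v j⟩⟩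
  calc 3 = (range (fun j : Fin 3 => (j, decide (s v = 1)))).ncard := by
        rw [← image_univ, ncard_image_of_injective _ fun a b h => (Prod.mk.inj h).1]
        simp
    _ ≤ _ := ncard_le_ncard hsub (Set.toFinite _)

/-- The leaves cannot have the directions `-w j`: the support would leave the triangle along a
half-line that finitely many half-lines in the directions `w k` do not cover. -/
lemma isConfined_of_memMr [Fintype V] (hw : IsTriad w) (hf : T.IsImmersion w f) {r : ℝ}
    (hr : 0 < r) (hm : MemMr w r (T.treeMeasure f)) : T.IsConfined w f s r := by
  obtain ⟨-, hbranch, F, hF, -, hsupp⟩ := hm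
  refine { hs with
    mem_triangle := fun v => hbranch _ (hs.isBranchPoint_point hw hf v)
    leaf_sign := fun v j hleaf => ?_ }
  by_contra hne
  have hs1 : s v = -1 := (hs.sign v).resolve_left hne
  set x := sideCoord w r (j + 2) (f (T.point v)) with hx
  have hx0 : 0 ≤ x := (hw.mem_triangle_iff hr).1 (hbranch _ (hs.isBranchPoint_point hw hf v)) _
  have hmem : ∀ n : ℕ, ∃ p ∈ F, (f (T.point v) - (x + 1) • w j) + ((n : ℝ) * (-1)) • w j
      ∈ ray p.1 (w p.2) := by
    intro n
    have : (f (T.point v) - (x + 1) • w j) + ((n : ℝ) * (-1)) • w j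
        ∈ (T.treeMeasure f).support \ triangle w r := by
      constructor
      · rw [hs.support_eq hw hf]
        refine mem_iUnion.2 ⟨(v, j), ?_⟩
        rw [hs.leaf_piece hleaf, hs1]
        exact ⟨x + 1 + n, by simp only [mem_Ici]; positivity, by simp only; module⟩
      · intro h
        have := (hw.mem_triangle_iff hr).1 h (j + 2)
        rw [sub_eq_add_neg, sideCoord_add, sideCoord_add, ← hx, map_neg, map_smul, map_smul,
          hw.succ_succ_sideForm, smul_eq_mul, smul_eq_mul] at this
        have : (0 : ℝ) ≤ n := n.cast_nonneg
        linarith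
    rw [hsupp] at this
    obtain ⟨p, hp, h⟩ := mem_iUnion₂.1 this
    exact ⟨p, hp, h⟩
  obtain ⟨⟨P, k⟩, -, hfreq⟩ := exists_frequently_of_finite hF hmem
  obtain ⟨rfl, -⟩ := hw.of_frequently_mem_ray (by norm_num) hfreq
  -- far out on the leaf the coordinate `j + 2` is smaller than on the covering half-line
  obtain ⟨m, hm⟩ := exists_nat_gt (-sideCoord w r (j + 2) P)
  obtain ⟨n, hn, t, ht, e⟩ := frequently_atTop.1 hfreq m
  have e' := congrArg (sideCoord w r (j + 2)) e
  simp only [sub_eq_add_neg, sideCoord_add, ← hx, map_neg, map_smul, hw.succ_succ_sideForm,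
    smul_eq_mul] at e'
  have h1 : (m : ℝ) ≤ n := by exact_mod_cast hn
  have h2 : (0 : ℝ) < t := ht
  linarith

end IsSigned

/-- The point where the leaf of type `j` at `v` leaves the triangle of size `r`. -/
noncomputable def exitPoint (T : TypedTree V) (w : Fin 3 → Plane) (r : ℝ) (f : T.Space → Plane)
    (v : V) (j : Fin 3) : Plane :=
  f (T.point v) + sideCoord w r (j + 1) (f (T.point v)) • w j

lemma sideCoord_exitPoint (hw : IsTriad w) (r : ℝ) (v : V) (j : Fin 3) :
    sideCoord w r j (T.exitPoint w r f v j) = sideCoord w r j (f (T.point v)) ∧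
      sideCoord w r (j + 1) (T.exitPoint w r f v j) = 0 := by
  simp [exitPoint, sideCoord_add, hw.sideForm_self, hw.succ_sideForm]

lemma hasCoord_unique (hw : IsTriad w) {r : ℝ} {A : Plane} {j k : Fin 3} {x y : ℝ}
    (h : HasCoord w r A j x) (h' : HasCoord w r A k y) : j = k ∧ x = y := by
  rw [hw.hasCoord_iff] at h h'
  obtain ⟨h1, h2, h3, h4⟩ := h
  obtain ⟨h1', h2', h3', h4'⟩ := h'
  rcases fin3_cases j k with rfl | rfl | rfl
  · exact ⟨rfl, h3.symm.trans h3'⟩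
  · linarith
  · rw [fin3_two_one] at h4'; linarith

lemma eq_corner_of_sideCoord (hw : IsTriad w) {r : ℝ} {A : Plane} {j : Fin 3}
    (h : sideCoord w r j A = 0) (h' : sideCoord w r (j + 1) A = 0) : A = corner w r j := by
  obtain ⟨h0, h1, -⟩ := hw.sideCoord_corner r j
  exact hw.ext_sideCoord_two j (h.trans h0.symm) (h'.trans h1.symm)

/-- An extremal branch point shows that all branch points lie in the triangle if the leaves do. -/
lemma mem_triangle_of_leaf [Finite V] (hs : T.IsSigned w f s) (hw : IsTriad w) {r : ℝ} (hr : 0 < r)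
    (hleaf : ∀ v j, T.nbr j v = none → s v = 1 ∧ 0 ≤ sideCoord w r j (f (T.point v))) (v : V) :
    f (T.point v) ∈ triangle w r := by
  rw [hw.mem_triangle_iff hr]
  intro k
  have : Nonempty V := ⟨v⟩
  obtain ⟨m, hm⟩ := Finite.exists_min fun v => sideCoord w r k (f (T.point v))
  refine le_trans ?_ (hm v)
  -- at a minimum the sign is `1`, since otherwise the form decreases along the edge `k + 1`
  have hsign : ∀ u, sideCoord w r k (f (T.point u)) ≤ sideCoord w r k (f (T.point m)) →
      s u = 1 := by
    intro u hu
    rcases h : T.nbr (k + 1) u with _ | u'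
    · exact (hleaf u _ h).1
    · refine (hs.sign u).resolve_right fun h1 => ?_
      obtain ⟨l, hl, e, -⟩ := hs.edge u (k + 1) u' h
      have := hm u'
      rw [e, sideCoord_add, map_smul, map_smul, hw.sideForm_succ, h1] at this
      simp only [smul_eq_mul] at this
      linarith
  rcases h : T.nbr k m with _ | u
  · exact (hleaf m k h).2
  · exfalso
    obtain ⟨l, hl, e, -⟩ := hs.edge m k u h
    have h1 := hs.eq_neg hw h
    rw [hsign m le_rfl, hsign u] at h1
    · norm_num at h1
    · rw [e, sideCoord_add, map_smul, map_smul, hw.sideForm_self]; simp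

namespace IsConfined

variable {r : ℝ} (hc : T.IsConfined w f s r)
include hc

lemma sideCoord_nonneg (hw : IsTriad w) (hr : 0 < r) (v : V) (j : Fin 3) :
    0 ≤ sideCoord w r j (f (T.point v)) :=
  (hw.mem_triangle_iff hr).1 (hc.mem_triangle v) j

lemma sideCoord_eq_of_nbr (hw : IsTriad w) {v u : V} {j : Fin 3} (h : T.nbr j v = some u) :
    sideCoord w r j (f (T.point v)) = sideCoord w r j (f (T.point u)) := by
  obtain ⟨l, hl, e, -⟩ := hc.edge v j u h
  rw [e, sideCoord_add, map_smul, map_smul, hw.sideForm_self]; simp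

lemma leaf_piece' {v : V} {j : Fin 3} (h : T.nbr j v = none) :
    T.piece f (v, j) = (fun t : ℝ => f (T.point v) + t • w j) '' Ici 0 := by
  rw [hc.leaf_piece h, hc.leaf_sign v j h, one_smul]

lemma edge_piece_subset {v u : V} {j : Fin 3} (h : T.nbr j v = some u) :
    T.piece f (v, j) ⊆ triangle w r := by
  rw [hc.edge_piece h]
  exact (convex_triangle w r).segment_subset (hc.mem_triangle v) (hc.mem_triangle u)

lemma exitPoint_mem (hw : IsTriad w) (hr : 0 < r) (v : V) (j : Fin 3) :
    T.exitPoint w r f v j ∈ triangle w r := by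
  rw [hw.mem_triangle_iff hr]
  obtain ⟨h0, h1⟩ := sideCoord_exitPoint (T := T) (f := f) hw r v j
  have h2 := sideCoord_sum w r j (T.exitPoint w r f v j)
  have h3 := sideCoord_sum w r j (f (T.point v))
  have := hc.sideCoord_nonneg hw hr v
  intro k
  rcases fin3_cases j k with rfl | rfl | rfl
  · rw [h0]; exact this _
  · exact h1.ge
  · linarith [this j, this (j + 1), this (j + 2)]

lemma leaf_piece_diff (hw : IsTriad w) (hr : 0 < r) {v : V} {j : Fin 3} (h : T.nbr j v = none) :
    T.piece f (v, j) \ triangle w r = ray (T.exitPoint w r f v j) (w j) := by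
  have hx := hc.sideCoord_nonneg hw hr v (j + 1)
  rw [hc.leaf_piece' h]
  ext y
  constructor
  · rintro ⟨⟨t, ht, rfl⟩, hy⟩
    refine ⟨t - sideCoord w r (j + 1) (f (T.point v)), ?_, ?_⟩
    · rw [mem_Ioi, sub_pos]
      by_contra! hle
      refine hy ((convex_triangle w r).segment_subset (hc.mem_triangle v)
        (hc.exitPoint_mem hw hr v j) ?_)
      rcases hx.eq_or_lt with h0 | h0
      · have : t = 0 := le_antisymm (hle.trans h0.ge) ht
        simp [this, left_mem_segment]
      · rw [segment_eq_image']
        refine ⟨t / sideCoord w r (j + 1) (f (T.point v)),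
          ⟨div_nonneg ht hx, div_le_one_of_le₀ hle hx⟩, ?_⟩
        simp only [exitPoint, add_sub_cancel_left, smul_smul]
        rw [div_mul_cancel₀ _ h0.ne']
    · simp only [exitPoint]; module
  · rintro ⟨t, ht, rfl⟩
    have ht' : 0 < t := ht
    refine ⟨⟨sideCoord w r (j + 1) (f (T.point v)) + t, ?_, ?_⟩, ?_⟩
    · simp only [mem_Ici]; linarith
    · simp only [exitPoint]; module
    · exact hw.notMem_triangle_of_pos hr (sideCoord_exitPoint hw r v j).2.le ht

lemma support_diff [Fintype V] (hw : IsTriad w) (hf : T.IsImmersion w f) (hr : 0 < r) :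
    (T.treeMeasure f).support \ triangle w r
      = ⋃ a ∈ {a : V × Fin 3 | T.nbr a.2 a.1 = none}, ray (T.exitPoint w r f a.1 a.2) (w a.2) := by
  rw [hc.support_eq hw hf, iUnion_sdiff]
  ext y
  simp only [mem_iUnion, mem_ofPred_eq, exists_prop]
  constructor
  · rintro ⟨⟨v, j⟩, hy⟩
    rcases h : T.nbr j v with _ | u
    · exact ⟨(v, j), h, hc.leaf_piece_diff hw hr h ▸ hy⟩
    · exact (hy.2 (hc.edge_piece_subset h hy.1)).elim
  · rintro ⟨⟨v, j⟩, h, hy⟩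
    exact ⟨(v, j), hc.leaf_piece_diff hw hr h ▸ hy⟩

lemma mem_exitPointsIn [Fintype V] (hw : IsTriad w) (hf : T.IsImmersion w f) (hr : 0 < r)
    {j : Fin 3} {A : Plane} : A ∈ exitPointsIn w r (T.treeMeasure f) j ↔
      ∃ v, T.nbr j v = none ∧ A = T.exitPoint w r f v j := by
  constructor
  · rintro ⟨hA, hray⟩
    have hmem : ∀ n : ℕ, ∃ a ∈ {a : V × Fin 3 | T.nbr a.2 a.1 = none},
        (A + w j) + ((n : ℝ) * 1) • w j ∈ ray (T.exitPoint w r f a.1 a.2) (w a.2) := by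
      intro n
      have h1 : (A + w j) + ((n : ℝ) * 1) • w j ∈ ray A (w j) :=
        ⟨1 + n, by simp only [mem_Ioi]; positivity, by simp only; module⟩
      have h2 := hray h1
      rw [hc.support_diff hw hf hr] at h2
      obtain ⟨a, ha, h⟩ := mem_iUnion₂.1 h2
      exact ⟨a, ha, h⟩
    obtain ⟨⟨v, k⟩, ha, hfreq⟩ := exists_frequently_of_finite (Set.toFinite _) hmem
    obtain ⟨rfl, e⟩ := hw.of_frequently_mem_ray one_ne_zero hfreq
    refine ⟨v, ha, ?_⟩
    simp only [map_add, hw.sideForm_self, add_zero] at e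
    have hx := (sideCoord_exitPoint (T := T) (f := f) hw r v j).2
    refine hw.ext_sideCoord_two (r := r) j (by simp [sideCoord, e]) (hx ▸ ?_)
    -- otherwise the exit point lies on the open half-line from `A`, which avoids the triangle
    have h0 := (hw.mem_triangle_iff hr).1 (mem_triangle_of_mem_frontier hA) (j + 1)
    refine (h0.eq_or_lt.resolve_right fun hlt => ?_).symm
    refine (hray ⟨sideCoord w r (j + 1) A, hlt, rfl⟩).2 ?_
    have : A + sideCoord w r (j + 1) A • w j = T.exitPoint w r f v j := by
      refine hw.ext_sideCoord_two (r := r) j ?_ ?_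
      · simp [sideCoord, e, hw.sideForm_self]
      · rw [hx, sideCoord_add, map_smul, hw.succ_sideForm]; simp
    simp only
    rw [this]
    exact hc.exitPoint_mem hw hr v j
  · rintro ⟨v, h, rfl⟩
    refine ⟨hw.mem_frontier_triangle hr (hc.exitPoint_mem hw hr v j)
      (sideCoord_exitPoint hw r v j).2, ?_⟩
    rw [hc.support_diff hw hf hr]
    exact subset_biUnion_of_mem
      (u := fun a : V × Fin 3 => ray (T.exitPoint w r f a.1 a.2) (w a.2))
      (show (v, j) ∈ {a : V × Fin 3 | T.nbr a.2 a.1 = none} from h)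

/-- The attachment points are the exit points of the leaves that do not leave the triangle at the
starting corner of their side. -/
lemma mem_attachmentPoints [Fintype V] (hw : IsTriad w) (hf : T.IsImmersion w f) (hr : 0 < r)
    {A : Plane} : A ∈ attachmentPoints w r (T.treeMeasure f) ↔
      ∃ v j, T.nbr j v = none ∧ 0 < sideCoord w r j (f (T.point v)) ∧
        A = T.exitPoint w r f v j := by
  constructor
  · rintro ⟨⟨j, hj⟩, h⟩
    rcases h with h | ⟨k, hk, hray⟩
    · obtain ⟨v, hv, rfl⟩ := (hc.mem_exitPointsIn hw hf hr).1 hj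
      refine ⟨v, j, hv, (hc.sideCoord_nonneg hw hr v j).lt_of_ne fun h0 => h ?_, rfl⟩
      obtain ⟨h1, h2⟩ := sideCoord_exitPoint (T := T) (f := f) hw r v j
      exact ⟨j, (eq_corner_of_sideCoord hw (h1.trans h0.symm) h2).symm⟩
    · obtain ⟨h0, h1, h2⟩ := hw.sideCoord_corner r k
      have hk' : A ∈ exitPointsIn w r (T.treeMeasure f) (k + 2) := by
        refine ⟨hj.1, fun y hy => ⟨hray hy, ?_⟩⟩
        obtain ⟨t, ht, rfl⟩ := hy
        refine hw.notMem_triangle_of_pos hr ?_ ht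
        rw [fin3_two_one, hk, h0]
      obtain ⟨v, hv, e⟩ := (hc.mem_exitPointsIn hw hf hr).1 hk'
      refine ⟨v, k + 2, hv, ?_, e⟩
      rw [← (sideCoord_exitPoint (T := T) (f := f) hw r v (k + 2)).1, ← e, hk, h2]
      exact hr
  · rintro ⟨v, j, hv, hpos, rfl⟩
    have hexit : T.exitPoint w r f v j ∈ exitPointsIn w r (T.treeMeasure f) j :=
      (hc.mem_exitPointsIn hw hf hr).2 ⟨v, hv, rfl⟩
    refine ⟨⟨j, hexit⟩, or_iff_not_imp_left.2 fun h => ?_⟩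
    obtain ⟨k, hk⟩ := not_not.1 h
    refine ⟨k, hk.symm, ?_⟩
    obtain ⟨e0, e1⟩ := sideCoord_exitPoint (T := T) (f := f) hw r v j
    obtain ⟨h0, h1, h2⟩ := hw.sideCoord_corner r k
    rw [hk] at h0 h1 h2
    have hkj : k + 2 = j := by
      rcases fin3_cases k j with rfl | rfl | rfl
      · linarith
      · linarith
      · rfl
    rw [hkj]
    exact hexit.2.trans Set.sdiff_subset

lemma hasCoord_exitPoint (hw : IsTriad w) (hr : 0 < r) {v : V} {j : Fin 3}
    (h : 0 < sideCoord w r j (f (T.point v))) :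
    HasCoord w r (T.exitPoint w r f v j) j (sideCoord w r j (f (T.point v))) := by
  have h0 := hc.sideCoord_nonneg hw hr v
  obtain ⟨e0, e1⟩ := sideCoord_exitPoint (T := T) (f := f) hw r v j
  exact hw.hasCoord_iff.2
    ⟨h, by linarith [sideCoord_sum w r j (f (T.point v)), h0 (j + 1), h0 (j + 2)], e0, e1⟩

open Classical in
lemma density_eq_sum [Fintype V] (hw : IsTriad w) (hf : T.IsImmersion w f) (A : Plane) (j : Fin 3)
    {c : ℝ} (hcc : c = 1 ∨ c = -1) : density (T.treeMeasure f) A (c • w j)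
      = ∑ v, if s v = 1 then (if HasGerm (T.piece f (v, j)) A (c • w j) then 1 else 0) else 0 := by
  have hc0 : c ≠ 0 := by rcases hcc with h | h <;> rw [h] <;> norm_num
  have hn : ‖c • w j‖ = 1 := by
    rw [norm_smul, hw.norm_eq]
    rcases hcc with h | h <;> rw [h] <;> norm_num
  rw [hc.density_eq hw hf A hn, edges, Finset.filter_filter, Finset.card_filter, Nat.cast_sum,
    Fintype.sum_prod_type]
  refine Finset.sum_congr rfl fun v _ => ?_
  rw [Finset.sum_eq_single j]
  · have : (T.nbr j v = none ∨ s v = 1) ↔ s v = 1 :=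
      ⟨fun h => h.elim (hc.leaf_sign v j) id, Or.inr⟩
    simp only [this]
    split_ifs <;> simp_all
  · intro k _ hk
    rw [if_neg, Nat.cast_zero]
    rintro ⟨-, h⟩
    exact hk (hc.eq_of_germ_piece hw hc0 h).symm
  · simp

open Classical in
/-- The balance at `A` is the sum of the signs of the branch points over `A`, so it does not depend
on the direction. -/
lemma balance [Fintype V] (hw : IsTriad w) (hf : T.IsImmersion w f) (A : Plane) (j : Fin 3) :
    density (T.treeMeasure f) A (w j) - density (T.treeMeasure f) A (-w j)
      = ∑ v, if f (T.point v) = A then s v else 0 := by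
  have h1 := hc.density_eq_sum hw hf A j (c := 1) (Or.inl rfl)
  have h2 := hc.density_eq_sum hw hf A j (c := -1) (Or.inr rfl)
  simp only [one_smul, neg_smul] at h1 h2
  rw [h1, h2, ← Finset.sum_sub_distrib]
  have h3 : ∀ v, ((if s v = 1 then (if HasGerm (T.piece f (v, j)) A (w j) then 1 else 0) else 0 : ℝ)
        - if s v = 1 then (if HasGerm (T.piece f (v, j)) A (-w j) then 1 else 0) else 0)
      = (if s v = 1 then (if f (T.point v) = A then 1 else 0) else 0)
        - if s v = 1 then
          (if T.nbr j v ≠ none ∧ f (T.point (T.partner j v)) = A then 1 else 0) else 0 := by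
    intro v
    by_cases hv : s v = 1
    · simp only [hv, if_true]
      exact hc.germ_sub_germ hw j hv A
    · simp [hv]
  rw [Finset.sum_congr rfl fun v _ => h3 v, Finset.sum_sub_distrib,
    ← T.sum_partner j fun v => if s v = 1 then
          (if T.nbr j v ≠ none ∧ f (T.point (T.partner j v)) = A then 1 else 0) else 0,
    ← Finset.sum_sub_distrib]
  refine Finset.sum_congr rfl fun v _ => ?_
  rw [T.partner_involutive j v]
  simp only [ne_eq, nbr_partner_eq_none_iff]
  rcases h : T.nbr j v with _ | u
  · simp [hc.leaf_sign v j h]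
  · rw [partner_of_some h, hc.eq_neg hw h]
    have hu : ¬some u = none := Option.some_ne_none u
    rcases hc.sign v with h1 | h1 <;> by_cases hA : f (T.point v) = A <;> norm_num [h1, hA, hu]

/-- Outside the triangle the leaves of different types are disjoint. -/
lemma ncard_lt_of_notMem [Fintype V] (hw : IsTriad w) (hf : T.IsImmersion w f) (hr : 0 < r)
    {A : Plane} (hA : A ∉ triangle w r) :
    {p : Fin 3 × Bool |
      density (T.treeMeasure f) A (if p.2 then w p.1 else -w p.1) ≠ 0}.ncard < 3 := by
  classical
  -- a direction with nonzero density is recognized by the sign of the coordinates at `A`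
  have key : ∀ p : Fin 3 × Bool,
      density (T.treeMeasure f) A (if p.2 then w p.1 else -w p.1) ≠ 0 →
      0 ≤ sideCoord w r p.1 A ∧ sideCoord w r (p.1 + 1) A < 0 ∧ 0 ≤ sideCoord w r (p.1 + 2) A := by
    rintro ⟨j, b⟩ hp
    obtain ⟨c, hc1, hcb⟩ : ∃ c : ℝ, (c = 1 ∨ c = -1) ∧ (if b then w j else -w j) = c • w j := by
      cases b
      · exact ⟨-1, Or.inr rfl, by simp⟩
      · exact ⟨1, Or.inl rfl, by simp⟩
    have hn : ‖c • w j‖ = 1 := by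
      rw [norm_smul, hw.norm_eq]
      rcases hc1 with h | h <;> rw [h] <;> norm_num
    simp only at hp
    rw [hcb, hc.density_eq_sum hw hf A j hc1] at hp
    obtain ⟨v, -, hv⟩ := Finset.exists_ne_zero_of_sum_ne_zero hp
    have hG : HasGerm (T.piece f (v, j)) A (c • w j) := by
      by_contra h
      simp [h] at hv
    have hmem := hG.mem_of_isClosed (hc.isClosed_piece hw (v, j)) hn
    rcases h : T.nbr j v with _ | u
    · rw [hc.leaf_piece' h] at hmem
      obtain ⟨t, ht, rfl⟩ := hmem
      have ht' : 0 ≤ t := ht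
      have h0 := hc.sideCoord_nonneg hw hr v
      have e0 : 0 ≤ sideCoord w r j (f (T.point v) + t • w j) := by
        rw [sideCoord_add, map_smul, hw.sideForm_self]; simpa using h0 j
      have e2 : 0 ≤ sideCoord w r (j + 2) (f (T.point v) + t • w j) := by
        rw [sideCoord_add, map_smul, hw.succ_succ_sideForm, smul_eq_mul]; linarith [h0 (j + 2)]
      refine ⟨e0, ?_, e2⟩
      by_contra! e1
      refine hA ((hw.mem_triangle_iff hr).2 fun k => ?_)
      rcases fin3_cases j k with rfl | rfl | rfl
      exacts [e0, e1, e2]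
    · exact (hA (hc.edge_piece_subset h hmem)).elim
  by_contra! h3
  obtain ⟨p, hp⟩ := nonempty_of_ncard_ne_zero (Nat.ne_of_gt (zero_lt_three.trans_le h3))
  have hsub : {p : Fin 3 × Bool |
      density (T.treeMeasure f) A (if p.2 then w p.1 else -w p.1) ≠ 0} ⊆
      (fun b : Bool => (p.1, b)) '' univ := by
    rintro ⟨k, b⟩ hk
    obtain ⟨a0, a1, a2⟩ := key p hp
    obtain ⟨b0, b1, b2⟩ := key _ hk
    refine ⟨b, mem_univ _, ?_⟩
    simp only at b0 b1 b2
    rcases fin3_cases p.1 k with rfl | rfl | rfl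
    · rfl
    · linarith
    · rw [fin3_two_one] at b1; linarith
  have h2 := (ncard_le_ncard hsub (Set.toFinite _)).trans (ncard_image_le (Set.toFinite _))
  rw [ncard_univ, Nat.card_eq_fintype_card, Fintype.card_bool] at h2
  omega

lemma memMr [Fintype V] (hw : IsTriad w) (hf : T.IsImmersion w f) (hr : 0 < r) :
    MemMr w r (T.treeMeasure f) := by
  classical
  refine ⟨⟨hc.isPolygonal_treeMeasure hw hf, fun A j k => ?_⟩, fun A hA => ?_, ?_⟩
  · rw [hc.balance hw hf, hc.balance hw hf]
  · by_contra hout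
    exact absurd hA (not_le.2 (hc.ncard_lt_of_notMem hw hf hr hout))
  · refine ⟨(fun a : V × Fin 3 => (T.exitPoint w r f a.1 a.2, a.2)) ''
      {a : V × Fin 3 | T.nbr a.2 a.1 = none}, (Set.toFinite _).image _, ?_, ?_⟩
    · rintro _ ⟨⟨v, j⟩, -, rfl⟩
      exact hw.mem_frontier_triangle hr (hc.exitPoint_mem hw hr v j)
        (sideCoord_exitPoint hw r v j).2
    · rw [hc.support_diff hw hf hr, biUnion_image]

open Classical in
/-- The exit density counts the leaves with the given coordinate. -/
lemma density_exit [Fintype V] (hw : IsTriad w) (hf : T.IsImmersion w f) (hr : 0 < r) {A : Plane}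
    {j : Fin 3} (hA : sideCoord w r (j + 1) A = 0) : density (T.treeMeasure f) A (w j)
      = ∑ v, if T.nbr j v = none ∧ sideCoord w r j (f (T.point v)) = sideCoord w r j A
          then 1 else 0 := by
  have h1 := hc.density_eq_sum hw hf A j (c := 1) (Or.inl rfl)
  rw [one_smul] at h1
  rw [h1]
  refine Finset.sum_congr rfl fun v _ => ?_
  rcases h : T.nbr j v with _ | u
  · simp only [hc.leaf_sign v j h, if_true, true_and]
    refine if_congr ?_ rfl rfl
    rw [hc.leaf_piece' h, germ_image_iff (hw.ne_zero j)]
    simp only [exists_Ioo_subset_Ici]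
    constructor
    · rintro ⟨t, rfl, -⟩
      rw [sideCoord_add, map_smul, hw.sideForm_self]; simp
    · intro e
      refine ⟨sideCoord w r (j + 1) (f (T.point v)), ?_, hc.sideCoord_nonneg hw hr v (j + 1)⟩
      obtain ⟨e0, e1⟩ := sideCoord_exitPoint (T := T) (f := f) hw r v j
      exact hw.ext_sideCoord_two (r := r) j (e.symm.trans e0.symm) (hA.trans e1.symm)
  · have hG : ¬ HasGerm (T.piece f (v, j)) A (w j) := by
      intro hG
      obtain ⟨t, ht, -, hmem⟩ := hG.exists_lt one_pos
      exact hw.notMem_triangle_of_pos hr hA.le ht (hc.edge_piece_subset h hmem)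
    simp [hG]

open Classical in
lemma card_leaves [Fintype V] (hw : IsTriad w) (j : Fin 3) :
    ∑ v, (if T.nbr j v = none then (1 : ℝ) else 0) = ∑ v, s v := by
  rw [← sum_sign_mul j (fun v u => hc.eq_neg hw) (fun v => hc.leaf_sign v j) (fun _ => 1)
    fun _ _ _ => rfl]
  simp

lemma weight_eq [Fintype V] (hw : IsTriad w) (hf : T.IsImmersion w f) (hr : 0 < r) :
    weight w r (T.treeMeasure f) = ∑ v, s v := by
  classical
  rw [← hc.card_leaves hw 0]
  set L : Finset V := Finset.univ.filter fun v => T.nbr 0 v = none with hL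
  have hset : exitPointsIn w r (T.treeMeasure f) 0
      = (L.image fun v => T.exitPoint w r f v 0 : Finset Plane) := by
    ext A
    rw [hc.mem_exitPointsIn hw hf hr]
    simp [hL, eq_comm]
  rw [weight, hset, finsum_mem_coe_finset, ← Finset.sum_filter, Finset.sum_const, nsmul_one, ← hL,
    Finset.card_eq_sum_card_image (fun v => T.exitPoint w r f v 0) L, Nat.cast_sum]
  refine Finset.sum_congr rfl fun A hA => ?_
  obtain ⟨u, -, rfl⟩ := Finset.mem_image.1 hA
  obtain ⟨e0, e1⟩ := sideCoord_exitPoint (T := T) (f := f) hw r u 0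
  rw [hc.density_exit hw hf hr e1, ← Finset.sum_filter, Finset.sum_const, nsmul_one,
    hL, Finset.filter_filter]
  congr 2
  refine Finset.filter_congr fun v _ => and_congr_right fun _ => ?_
  obtain ⟨e0', e1'⟩ := sideCoord_exitPoint (T := T) (f := f) hw r v 0
  constructor
  · intro h
    exact hw.ext_sideCoord_two (r := r) 0 (e0'.trans (h.trans rfl)) (e1'.trans e1.symm)
  · intro h
    rw [← e0', h]

end IsConfined

end TypedTree

/-! ### Prescribing the lines of the leaves -/

namespace TypedTree

variable {V : Type*} {T : TypedTree V} {w : Fin 3 → Plane} {f : T.Space → Plane} {s : V → ℝ}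

/-- The graph of the edges between branch points. -/
abbrev graph (T : TypedTree V) : SimpleGraph V :=
  SimpleGraph.fromRel fun u v => ∃ j, T.nbr j u = some v

lemma isTree_graph (T : TypedTree V) : T.graph.IsTree := T.isTree

lemma graph_adj {u v : V} : T.graph.Adj u v ↔ ∃ j, T.nbr j u = some v := by
  rw [SimpleGraph.fromRel_adj]
  constructor
  · rintro ⟨-, h | ⟨j, h⟩⟩
    · exact h
    · exact ⟨j, T.nbr_symm _ _ _ h⟩
  · rintro ⟨j, h⟩
    refine ⟨?_, Or.inl ⟨j, h⟩⟩
    rintro rfl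
    exact T.nbr_irrefl j u h

/-- The first step of a shortest walk to `x`. -/
lemma exists_nbr_dist (T : TypedTree V) {x v : V} (hne : v ≠ x) :
    ∃ j u, T.nbr j v = some u ∧ T.graph.dist v x = T.graph.dist u x + 1 := by
  obtain ⟨p, hp⟩ := T.isTree_graph.connected.exists_walk_length_eq_dist v x
  cases p with
  | nil => exact (hne rfl).elim
  | @cons _ u _ h q =>
    obtain ⟨j, hj⟩ := graph_adj.1 h
    refine ⟨j, u, hj, ?_⟩
    have h1 := SimpleGraph.dist_le q
    have h2 : T.graph.dist v x ≤ T.graph.dist u x + 1 := by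
      have := T.isTree_graph.connected.dist_triangle (u := v) (v := u) (w := x)
      rw [SimpleGraph.dist_eq_one_iff_adj.2 h] at this
      omega
    rw [SimpleGraph.Walk.length_cons] at hp
    omega

/-- In a tree only one edge at `v` leads towards `x`. -/
lemma nbr_dist_unique (T : TypedTree V) {x v u u' : V} {j j' : Fin 3} (h : T.nbr j v = some u)
    (hd : T.graph.dist v x = T.graph.dist u x + 1) (h' : T.nbr j' v = some u')
    (hd' : T.graph.dist v x = T.graph.dist u' x + 1) : j = j' := by
  obtain ⟨p, hp⟩ := T.isTree_graph.connected.exists_walk_length_eq_dist u x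
  obtain ⟨p', hp'⟩ := T.isTree_graph.connected.exists_walk_length_eq_dist u' x
  have ha : T.graph.Adj v u := graph_adj.2 ⟨j, h⟩
  have ha' : T.graph.Adj v u' := graph_adj.2 ⟨j', h'⟩
  have h1 : (SimpleGraph.Walk.cons ha p).IsPath :=
    SimpleGraph.Walk.isPath_of_length_eq_dist _ (by rw [SimpleGraph.Walk.length_cons, hp, hd])
  have h2 : (SimpleGraph.Walk.cons ha' p').IsPath :=
    SimpleGraph.Walk.isPath_of_length_eq_dist _ (by rw [SimpleGraph.Walk.length_cons, hp', hd'])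
  have := (T.isTree_graph.existsUnique_path v x).unique h1 h2
  have huu : u = u' := by
    have := congrArg SimpleGraph.Walk.snd this
    simpa using this
  subst huu
  exact T.type_unique _ _ _ _ h h'

open Classical in
/-- For each branch point, the type of the edge that leads towards a given leaf. Of the two ends of
an edge, exactly one has to use this edge. -/
lemma exists_route (T : TypedTree V) {x : V} {k : Fin 3} (hk : T.nbr k x = none) :
    ∃ d : V → Fin 3, d x = k ∧ (∀ v, T.nbr (d v) v = none → v = x) ∧
      ∀ v u j, T.nbr j v = some u → (d u = j ↔ d v ≠ j) := by
  have hex : ∀ v, ∃ j, (v = x → j = k) ∧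
      (v ≠ x → ∃ u, T.nbr j v = some u ∧ T.graph.dist v x = T.graph.dist u x + 1) := by
    intro v
    by_cases h : v = x
    · exact ⟨k, fun _ => rfl, fun h' => (h' h).elim⟩
    · obtain ⟨j, hj⟩ := T.exists_nbr_dist h
      exact ⟨j, fun h' => (h h').elim, fun _ => hj⟩
  choose d hd1 hd2 using hex
  have key : ∀ v u j, T.nbr j v = some u → T.graph.dist v x = T.graph.dist u x + 1 →
      d v = j ∧ d u ≠ j := by
    intro v u j h hdist
    have hv : v ≠ x := by
      rintro rfl
      simp at hdist
    obtain ⟨u', hu', hdist'⟩ := hd2 v hv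
    refine ⟨T.nbr_dist_unique hu' hdist' h hdist, fun hj => ?_⟩
    have h' := T.nbr_symm _ _ _ h
    by_cases hux : u = x
    · rw [hux, ← hj, hd1 u hux, hk] at h'
      simp at h'
    · obtain ⟨u'', hu'', hdist''⟩ := hd2 u hux
      rw [hj, h', Option.some_inj] at hu''
      subst hu''
      omega
  refine ⟨d, hd1 x rfl, fun v hv => ?_, fun v u j h => ?_⟩
  · by_contra hne
    obtain ⟨u, hu, -⟩ := hd2 v hne
    simp [hu] at hv
  · rcases T.isTree_graph.dist_eq_dist_add_one_of_adj x (graph_adj.2 ⟨j, h⟩) with hdist | hdist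
    · rw [SimpleGraph.dist_comm, SimpleGraph.dist_comm (v := u)] at hdist
      have := key v u j h hdist
      tauto
    · rw [SimpleGraph.dist_comm, SimpleGraph.dist_comm (v := v)] at hdist
      have := key u v j (T.nbr_symm _ _ _ h) hdist
      tauto

open Classical in
/-- Arbitrary values on the leaves with sum zero extend to all edges in such a way that the values
around each branch point have sum zero. The value on an edge is, up to sign, the sum over the leaves
beyond it. -/
lemma exists_extension [Fintype V] (hsign : ∀ v, s v = 1 ∨ s v = -1)
    (hneg : ∀ v u j, T.nbr j v = some u → s u = -s v)
    (hleaf : ∀ v j, T.nbr j v = none → s v = 1) (τ : V → Fin 3 → ℝ)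
    (hτ : ∑ v, ∑ j, (if T.nbr j v = none then τ v j else 0) = 0) {c : ℝ} (hc0 : 0 ≤ c)
    (hc : ∀ v j, T.nbr j v = none → |τ v j| ≤ c) :
    ∃ d : V → Fin 3 → ℝ, (∀ v, ∑ j, d v j = 0) ∧
      (∀ v u j, T.nbr j v = some u → d v j = d u j) ∧
      (∀ v j, T.nbr j v = none → d v j = τ v j) ∧
      ∀ v j, |d v j| ≤ Fintype.card (V × Fin 3) * c := by
  have hex : ∀ a : V × Fin 3, ∃ d : V → Fin 3, T.nbr a.2 a.1 = none → d a.1 = a.2 ∧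
      (∀ v, T.nbr (d v) v = none → v = a.1) ∧
      ∀ v u j, T.nbr j v = some u → (d u = j ↔ d v ≠ j) := by
    intro a
    by_cases h : T.nbr a.2 a.1 = none
    · obtain ⟨d, hd⟩ := T.exists_route h
      exact ⟨d, fun _ => hd⟩
    · exact ⟨fun _ => 0, fun h' => (h h').elim⟩
  choose ρ hρ using hex
  set L : Finset (V × Fin 3) := Finset.univ.filter fun a => T.nbr a.2 a.1 = none with hL
  have hmem : ∀ a, a ∈ L ↔ T.nbr a.2 a.1 = none := by simp [hL]
  have hsum : ∑ a ∈ L, τ a.1 a.2 = 0 := by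
    rw [hL, Finset.sum_filter, Fintype.sum_prod_type, hτ]
  refine ⟨fun v j => s v * ∑ a ∈ L, if ρ a v = j then τ a.1 a.2 else 0, ?_, ?_, ?_, ?_⟩
  · intro v
    rw [← Finset.mul_sum, Finset.sum_comm]
    simp [hsum]
  · intro v u j h
    have : ∑ a ∈ L, (if ρ a v = j then τ a.1 a.2 else 0)
        + ∑ a ∈ L, (if ρ a u = j then τ a.1 a.2 else 0) = 0 := by
      rw [← Finset.sum_add_distrib, ← hsum]
      refine Finset.sum_congr rfl fun a ha => ?_
      have := (hρ a ((hmem a).1 ha)).2.2 v u j h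
      by_cases h1 : ρ a v = j <;> simp_all
    simp only [hneg v u j h]
    linear_combination s v * this
  · intro v j h
    simp only [hleaf v j h, one_mul]
    rw [Finset.sum_eq_single (v, j)]
    · rw [if_pos (hρ (v, j) h).1]
    · rintro a ha hne
      rw [if_neg]
      intro hj
      obtain ⟨h1, h2, -⟩ := hρ a ((hmem a).1 ha)
      have hva := h2 v (by rw [hj, h])
      subst hva
      exact hne (Prod.ext rfl (h1.symm.trans hj))
    · intro hn
      exact (hn ((hmem _).2 h)).elim
  · intro v j
    have hs1 : |s v| = 1 := by rcases hsign v with h | h <;> simp [h]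
    rw [abs_mul, hs1, one_mul]
    calc |∑ a ∈ L, if ρ a v = j then τ a.1 a.2 else 0|
        ≤ ∑ a ∈ L, |if ρ a v = j then τ a.1 a.2 else 0| := Finset.abs_sum_le_sum_abs _ _
      _ ≤ ∑ a ∈ L, c := Finset.sum_le_sum fun a ha => by
          split_ifs
          · exact hc a.1 a.2 ((hmem a).1 ha)
          · simpa using hc0
      _ = L.card * c := by rw [Finset.sum_const, nsmul_eq_mul]
      _ ≤ Fintype.card (V × Fin 3) * c := by
          exact mul_le_mul_of_nonneg_right (by exact_mod_cast Finset.card_le_univ L) hc0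

/-! ### Moving the branch points of an immersion -/

/-- If the branch points move to `p'` in such a way that the edges keep their directions, the
immersion can be carried along: it is scaled on the edges between branch points and translated on
the leaves. -/
lemma IsSigned.exists_deformation (hs : T.IsSigned w f s) (hw : IsTriad w)
    (hf : T.IsImmersion w f) (p' : V → Plane)
    (hp : ∀ v j u, T.nbr j v = some u → ∃ l : ℝ, 0 < l ∧ p' u = p' v + l • s v • w j) :
    ∃ g : T.Space → Plane, T.IsImmersion w g ∧ T.IsSigned w g s ∧ (∀ v, g (T.point v) = p' v) ∧
      ∀ ε, (∀ v, ‖f (T.point v) - p' v‖ < ε) → ∀ t, ‖f t - g t‖ < ε := by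
  have hex : ∀ a : V × Fin 3, ∃ c : ℝ, 0 < c ∧ (T.nbr a.2 a.1 = none → c = 1) ∧
      ∀ u, T.nbr a.2 a.1 = some u →
        p' u - p' a.1 = c • (f (T.point u) - f (T.point a.1)) := by
    rintro ⟨v, j⟩
    rcases h : T.nbr j v with _ | u
    · exact ⟨1, one_pos, fun _ => rfl, by simp⟩
    · obtain ⟨l, hl, e, -⟩ := hs.edge v j u h
      obtain ⟨l', hl', e'⟩ := hp v j u h
      refine ⟨l' / l, div_pos hl' hl, by simp, ?_⟩
      intro u' hu'
      simp only at hu' ⊢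
      rw [Option.some_inj] at hu'
      subst hu'
      rw [e, e', add_sub_cancel_left, add_sub_cancel_left, smul_smul (l' / l) l,
        div_mul_cancel₀ _ hl.ne']
  choose ρ hρ0 hρ1 hρ using hex
  have hne : ∀ v j u, T.nbr j v = some u → f (T.point u) - f (T.point v) ≠ 0 := by
    intro v j u h
    obtain ⟨l, hl, e, -⟩ := hs.edge v j u h
    rw [e, add_sub_cancel_left]
    exact smul_ne_zero hl.ne' (smul_ne_zero (hs.ne_zero v) (hw.ne_zero j))
  have hsymm : ∀ v j u, T.nbr j v = some u → ρ (v, j) = ρ (u, j) := by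
    intro v j u h
    have h1 := hρ (v, j) u h
    have h2 := hρ (u, j) v (T.nbr_symm _ _ _ h)
    simp only at h1 h2
    refine smul_left_injective ℝ (hne v j u h) ?_
    simp only
    rw [← h1, ← neg_sub (f (T.point v)), smul_neg, ← h2, neg_sub]
  let g : T.Space → Plane := Quot.lift
    (fun p : T.Pre => p' p.1.1 + ρ p.1 • (f (Quot.mk _ p) - f (T.point p.1.1))) (by
      rintro ⟨⟨v, j⟩, t, ht⟩ ⟨⟨u, k⟩, t', ht'⟩ h
      have hfe : f (Quot.mk _ ⟨(v, j), t, ht⟩) = f (Quot.mk _ ⟨(u, k), t', ht'⟩) :=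
        congrArg f (Quot.sound h)
      rcases h with ⟨h1, h2, h3⟩ | ⟨h1, h2, h3⟩
      · simp only at h1 h2 h3
        subst h1 h2 h3
        have e1 : f (Quot.mk _ ⟨(v, j), 0, ht⟩) = f (T.point v) :=
          congrArg f (T.arm_zero v j ht)
        have e2 : f (Quot.mk _ ⟨(v, k), 0, ht'⟩) = f (T.point v) :=
          congrArg f (T.arm_zero v k ht')
        simp only [e1, e2, sub_self, smul_zero]
      · simp only at h1 h2 h3
        subst h2
        simp only
        have e := hρ (v, j) u h1
        simp only at e
        rw [hfe, ← hsymm v j u h1, ← sub_eq_zero]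
        have e' : p' u = p' v + ρ (v, j) • (f (T.point u) - f (T.point v)) := by
          rw [← e]; abel
        rw [e']
        module)
  have hg : ∀ v j t, g (T.arm v j t) = p' v + ρ (v, j) • (f (T.arm v j t) - f (T.point v)) :=
    fun _ _ _ => rfl
  have hgp : ∀ v, g (T.point v) = p' v := by
    intro v
    rw [← T.arm_zero v 0 (T.zero_mem_params _), hg, T.arm_zero]
    simp
  have hrange : ∀ v j, range (g ∘ T.arm v j)
      = (fun y => p' v + ρ (v, j) • (y - f (T.point v))) '' range (f ∘ T.arm v j) := by
    intro v j
    rw [← range_comp]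
    rfl
  have hsg : T.IsSigned w g s := by
    refine ⟨hs.sign, fun v j u h => ?_, fun v j h => ?_⟩
    · obtain ⟨l, hl, e⟩ := hp v j u h
      refine ⟨l, hl, by rw [hgp, hgp, e], ?_⟩
      obtain ⟨-, -, -, hr⟩ := hs.edge v j u h
      rw [hrange, hr, hgp, hgp, segment_eq_image', segment_eq_image', image_image]
      have e := hρ (v, j) u h
      simp only at e
      refine image_congr fun θ _ => ?_
      rw [e]
      module
    · rw [hrange, hs.leaf v j h, image_image, hρ1 (v, j) h, hgp]
      refine image_congr fun t _ => ?_
      module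
  refine ⟨g, ⟨?_, fun v j => ?_, fun v => ⟨s v, hs.sign v, fun j => ⟨hsg.edge v j, hsg.leaf v j⟩⟩⟩,
    hsg, hgp, fun ε hε t => ?_⟩
  · refine continuous_quot_lift _ ?_
    refine continuous_sigma fun a => ?_
    have : Continuous fun t : T.params a => f (T.arm a.1 a.2 t) :=
      (hf.embedding a.1 a.2).continuous
    have hA : Continuous fun y : Plane => p' a.1 + ρ a • (y - f (T.point a.1)) := by fun_prop
    exact hA.comp this
  · let h : Plane ≃ₜ Plane := (Homeomorph.subRight (f (T.point v))).trans
      ((Homeomorph.smulOfNeZero (ρ (v, j)) (hρ0 _).ne').trans (Homeomorph.addLeft (p' v)))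
    exact h.isEmbedding.comp (hf.embedding v j)
  · obtain ⟨v, j, t, rfl⟩ := T.exists_arm t
    rw [hg]
    have hmem : f (T.arm v j t) ∈ T.piece f (v, j) := ⟨t, rfl⟩
    rcases h : T.nbr j v with _ | u
    · rw [hρ1 (v, j) h]
      convert hε v using 2
      module
    · rw [hs.edge_piece h, segment_eq_image'] at hmem
      obtain ⟨θ, hθ, e⟩ := hmem
      have e' := hρ (v, j) u h
      simp only at e e'
      have e2 : f (T.arm v j t)
          - (p' v + ρ (v, j) • (f (T.arm v j t) - f (T.point v)))
          = (1 - θ) • (f (T.point v) - p' v) + θ • (f (T.point u) - p' u) := by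
        rw [← e, add_sub_cancel_left, smul_comm, ← e']
        module
      rw [e2, ← mem_ball_zero_iff]
      exact convex_ball _ _ (mem_ball_zero_iff.2 (hε v)) (mem_ball_zero_iff.2 (hε u))
        (by linarith [hθ.2]) hθ.1 (by ring)

end TypedTree

/-! ### Perturbation of the leaves -/

lemma IsTriad.exists_sideForm_eq {w : Fin 3 → Plane} (hw : IsTriad w) {c : Fin 3 → ℝ}
    (hc : ∑ j, c j = 0) : ∃ x : Plane, ∀ j, sideForm w j x = c j := by
  have h0 : sideForm w 0 ((-c 1) • w 0 + c 0 • w 1) = c 0 := by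
    have a := hw.sideForm_self 0
    have b := hw.sideForm_succ 0
    simp only [Fin.isValue, zero_add] at a b
    simp [a, b]
  have h1 : sideForm w 1 ((-c 1) • w 0 + c 0 • w 1) = c 1 := by
    have a := hw.sideForm_self 1
    have b := hw.succ_sideForm 0
    simp only [Fin.isValue, zero_add] at a b
    simp [a, b]
  have h2 := sum_sideForm w ((-c 1) • w 0 + c 0 • w 1)
  rw [Fin.sum_univ_three] at h2 hc
  refine ⟨(-c 1) • w 0 + c 0 • w 1, fun j => ?_⟩
  fin_cases j
  · exact h0
  · exact h1
  · simp only [Fin.reduceFinMk]; linarith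

/-- If the terms of a vanishing sum are small except for those with one common value, then all of
them are small. -/
lemma abs_le_of_sum_eq_zero {ι : Type*} {S : Finset ι} {τ : ι → ℝ} {b ρ : ℝ} (hb : 0 ≤ b)
    (h : ∀ a ∈ S, |τ a| ≤ b ∨ τ a = ρ) (hsum : ∑ a ∈ S, τ a = 0) :
    ∀ a ∈ S, |τ a| ≤ S.card * b := by
  classical
  have key : ∀ τ : ι → ℝ, (∀ a ∈ S, -b ≤ τ a) → ∑ a ∈ S, τ a = 0 →
      ∀ a ∈ S, |τ a| ≤ S.card * b := by
    intro τ hτ hsum a ha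
    have h1 : ∑ c ∈ S, (τ c + b) = S.card * b := by
      rw [Finset.sum_add_distrib, hsum, Finset.sum_const, nsmul_eq_mul, zero_add]
    have h2 : τ a + b ≤ ∑ c ∈ S, (τ c + b) :=
      Finset.single_le_sum (f := fun c => τ c + b) (fun c hc => by linarith [hτ c hc]) ha
    have h3 : (1 : ℝ) ≤ S.card := by exact_mod_cast Finset.card_pos.2 ⟨a, ha⟩
    have h4 : b ≤ S.card * b := le_mul_of_one_le_left hb h3
    rw [abs_le]
    constructor <;> linarith [hτ a ha]
  rcases le_total 0 ρ with h0 | h0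
  · refine key τ (fun a ha => ?_) hsum
    rcases h a ha with h1 | h1
    · exact (abs_le.1 h1).1
    · linarith
  · intro a ha
    rw [← abs_neg]
    refine key (fun a => -τ a) (fun a ha => ?_)
      (by rw [Finset.sum_neg_distrib, hsum, neg_zero]) a ha
    rcases h a ha with h1 | h1
    · linarith [(abs_le.1 h1).2]
    · linarith

namespace TypedTree

variable {V : Type*} {T : TypedTree V} {w : Fin 3 → Plane} {f : T.Space → Plane} {s : V → ℝ}

lemma IsSigned.exists_length_bound [Finite V] (hs : T.IsSigned w f s) :
    ∃ m > 0, ∀ v j u, T.nbr j v = some u → ∃ l : ℝ, m ≤ l ∧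
      f (T.point u) = f (T.point v) + l • s v • w j := by
  have hex : ∀ a : V × Fin 3, ∃ l : ℝ, 0 < l ∧ ∀ u, T.nbr a.2 a.1 = some u →
      f (T.point u) = f (T.point a.1) + l • s a.1 • w a.2 := by
    rintro ⟨v, j⟩
    rcases h : T.nbr j v with _ | u
    · exact ⟨1, one_pos, by simp⟩
    · obtain ⟨l, hl, e, -⟩ := hs.edge v j u h
      exact ⟨l, hl, by simpa using e⟩
  choose l hl e using hex
  have : Nonempty V := T.isTree.connected.nonempty
  obtain ⟨a, ha⟩ := Finite.exists_min l
  exact ⟨l a, hl a, fun v j u h => ⟨l (v, j), ha _, e (v, j) u h⟩⟩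

namespace IsConfined

variable {r : ℝ} (hc : T.IsConfined w f s r)
include hc

open Classical in
/-- At each branch point the three coordinates have sum `r`; summation by parts turns this into a
relation between the leaves. -/
lemma sum_leaf_sideCoord [Fintype V] (hw : IsTriad w) (r : ℝ) :
    ∑ v, ∑ j, (if T.nbr j v = none then sideCoord w r j (f (T.point v)) else 0)
      = r * ∑ v, s v := by
  rw [Finset.sum_comm]
  have : ∀ j, ∑ v, (if T.nbr j v = none then sideCoord w r j (f (T.point v)) else 0)
      = ∑ v, s v * sideCoord w r j (f (T.point v)) := fun j =>
    (sum_sign_mul j (fun v u => hc.eq_neg hw) (fun v => hc.leaf_sign v j)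
      (fun v => sideCoord w r j (f (T.point v))) fun v u h => by
        simpa [sideCoord] using hc.sideCoord_eq_of_nbr hw h).symm
  simp only [this]
  rw [Finset.sum_comm, Finset.mul_sum]
  refine Finset.sum_congr rfl fun v _ => ?_
  rw [← Finset.mul_sum, sum_sideCoord, mul_comm]

open Classical in
/-- The leaves can be moved independently by small amounts, subject to the single condition on
the sum of their coordinates, and the size of the triangle can be changed at the same time. -/
lemma exists_moved [Fintype V] (hw : IsTriad w) (hf : T.IsImmersion w f) {ε : ℝ} (hε : 0 < ε) :
    ∃ η > 0, ∀ (r' : ℝ) (t : V → Fin 3 → ℝ), 0 < r' →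
      (∀ v j, T.nbr j v = none → 0 ≤ t v j) →
      ∑ v, ∑ j, (if T.nbr j v = none then t v j else 0) = r' * ∑ v, s v →
      (∀ v j, T.nbr j v = none → |t v j - sideCoord w r' j (f (T.point v))| ≤ η) →
      ∃ g : T.Space → Plane, T.IsImmersion w g ∧ T.IsConfined w g s r' ∧
        (∀ y, ‖f y - g y‖ < ε) ∧
        ∀ v j, T.nbr j v = none → sideCoord w r' j (g (T.point v)) = t v j := by
  obtain ⟨m, hm, hlen⟩ := hc.exists_length_bound
  have : Nonempty V := T.isTree.connected.nonempty
  set N : ℝ := (Fintype.card (V × Fin 3) : ℝ) with hN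
  have hN0 : 0 < N := by rw [hN]; exact_mod_cast Fintype.card_pos
  -- the displacements of the branch points are at most `2 / 5` of `ε` and of the shortest edge
  refine ⟨min ε m / (5 * N), by positivity, fun r' t hr' ht0 htsum hclose => ?_⟩
  have hη : 0 ≤ min ε m / (5 * N) := by positivity
  have hsum0 : ∑ v, ∑ j, (if T.nbr j v = none then t v j - sideCoord w r' j (f (T.point v)) else 0)
      = 0 := by
    have h1 := hc.sum_leaf_sideCoord hw r'
    have h2 := sub_eq_zero.2 (htsum.trans h1.symm)
    rw [← Finset.sum_sub_distrib] at h2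
    refine (Finset.sum_congr rfl fun v _ => ?_).trans h2
    rw [← Finset.sum_sub_distrib]
    refine Finset.sum_congr rfl fun j _ => ?_
    split_ifs <;> simp
  obtain ⟨d, hd0, hdedge, hdleaf, hdle⟩ := exists_extension hc.sign
    (fun v u j h => hc.eq_neg hw h) hc.leaf_sign
    (fun v j => t v j - sideCoord w r' j (f (T.point v))) hsum0 hη hclose
  choose D hD using fun v => hw.exists_sideForm_eq (hd0 v)
  have hDle : ∀ v, ‖D v‖ ≤ 2 / 5 * min ε m := by
    intro v
    refine (hw.norm_le_of_sideForm fun j => (hD v j).symm ▸ hdle v j).trans (le_of_eq ?_)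
    rw [← hN]; field_simp
  have hmin0 : 0 < min ε m := lt_min hε hm
  obtain ⟨g, hg, hsg, hgp, hgε⟩ := hc.exists_deformation hw hf (fun v => f (T.point v) + D v) (by
    intro v j u h
    obtain ⟨l, hl, e⟩ := hlen v j u h
    have hpar : sideForm w j (D u - D v) = 0 := by
      rw [map_sub, hD, hD, hdedge v u j h, sub_self]
    have e' := hw.eq_smul_of_sideForm_eq_zero hpar
    set κ := -sideForm w (j + 1) (D u - D v) with hκ
    have hκle : |κ| ≤ 4 / 5 * m := by
      have h1 : ‖D u - D v‖ = |κ| := by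
        rw [e', norm_smul, hw.norm_eq, mul_one, Real.norm_eq_abs]
      rw [← h1]
      refine (norm_sub_le _ _).trans ?_
      linarith [hDle u, hDle v, min_le_right ε m]
    have hss : s v * s v = 1 := by rcases hc.sign v with h | h <;> rw [h] <;> norm_num
    refine ⟨l + κ * s v, ?_, ?_⟩
    · have : |κ * s v| ≤ 4 / 5 * m := by
        rw [abs_mul]
        rcases hc.sign v with h | h <;> simpa [h] using hκle
      linarith [(abs_le.1 this).1]
    · have : D u = D v + κ • w j := by rw [← e']; abel
      rw [e, this, add_smul, smul_smul (κ * s v), mul_assoc, hss, mul_one]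
      abel)
  have hcoord : ∀ v j, T.nbr j v = none → sideCoord w r' j (g (T.point v)) = t v j := by
    intro v j h
    rw [hgp, sideCoord_add, hD, hdleaf v j h]; ring
  refine ⟨g, hg, { hsg with
    leaf_sign := hc.leaf_sign
    mem_triangle := fun v => mem_triangle_of_leaf hsg hw hr' (fun v j h =>
      ⟨hc.leaf_sign v j h, hcoord v j h ▸ ht0 v j h⟩) v }, ?_, hcoord⟩
  refine hgε ε fun v => ?_
  simp only [sub_add_cancel_left, norm_neg]
  linarith [hDle v, min_le_left ε m]

end IsConfined

end TypedTree

/-! ### Attachment points and the perturbed immersion -/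

lemma eventually_mul_lt (K : ℝ) {c : ℝ} (hc : 0 < c) : ∀ᶠ δ in 𝓝[>] (0 : ℝ), K * δ < c := by
  have h : Tendsto (fun δ : ℝ => K * δ) (𝓝 0) (𝓝 0) := by
    simpa using (continuous_const_mul K).tendsto 0
  exact (h.mono_left nhdsWithin_le_nhds).eventually (gt_mem_nhds hc)

/-- Attachment points cannot move across a corner: this would change the weighted sum of the
coordinates too much. -/
lemma side_eq_of_close {w : Fin 3 → Plane} (hw : IsTriad w) {q : ℕ} {A A' : Fin q → Plane}
    {side side' : Fin q → Fin 3} {x x' α : Fin q → ℝ} {r r' W δ : ℝ}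
    (hx : ∀ i, HasCoord w r (A i) (side i) (x i)) (hx' : ∀ i, HasCoord w r' (A' i) (side' i) (x' i))
    (hα : ∀ i, 1 ≤ α i) (hW : 0 ≤ W) (hsum : ∑ i, α i * x i = W * r)
    (hsum' : ∑ i, α i * x' i = W * r') (hA : ∀ i, ‖A' i - A i‖ < δ) (hr : |r' - r| < δ)
    (hδ : ∀ i, (3 * ∑ k, α k + W + 3) * δ < x i) (i : Fin q) : side' i = side i := by
  have hδ0 : 0 < δ := (abs_nonneg _).trans_lt hr
  -- a form changes by at most `2 * δ`, and the constant in a coordinate by at most `δ`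
  have hclose : ∀ i j, |sideCoord w r' j (A' i) - sideCoord w r j (A i)| ≤ 3 * δ := by
    intro i j
    have h1 := (hw.abs_sideForm_le j (A' i - A i)).trans
      (mul_le_mul_of_nonneg_left (hA i).le zero_le_two)
    have e : sideCoord w r' j (A' i) - sideCoord w r j (A i)
        = sideForm w j (A' i - A i) + if j = 1 then r' - r else 0 := by
      simp only [sideCoord, map_sub]
      split_ifs <;> ring
    rw [e]
    refine (abs_add_le _ _).trans ?_
    have h2 : |if j = 1 then r' - r else 0| ≤ δ := by
      split_ifs
      · exact hr.le
      · simpa using hδ0.le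
    linarith
  have hα0 : 0 ≤ ∑ k, α k := Finset.sum_nonneg fun k _ => zero_le_one.trans (hα k)
  have h3 : 3 * δ ≤ (3 * ∑ k, α k + W + 3) * δ :=
    mul_le_mul_of_nonneg_right (by linarith) hδ0.le
  -- if the side changes at all, then to the next one, with a small coordinate
  have hcase : ∀ i, side' i = side i ∨ x' i ≤ 3 * δ := by
    intro i
    obtain ⟨h0, h1, e0, e1⟩ := hw.hasCoord_iff.1 (hx i)
    obtain ⟨h0', h1', e0', e1'⟩ := hw.hasCoord_iff.1 (hx' i)
    rcases fin3_cases (side i) (side' i) with h | h | h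
    · exact Or.inl h
    · right
      have := hclose i (side i + 1)
      rw [e1, ← h, e0', sub_zero] at this
      exact (abs_le.1 this).2
    · exfalso
      have := hclose i (side i)
      rw [h, fin3_two_one] at e1'
      rw [e1', e0, zero_sub, abs_neg] at this
      linarith [(abs_le.1 this).2, hδ i]
  refine (hcase i).resolve_right fun hi => ?_
  have hle : ∀ k, x' k ≤ x k + 3 * δ := by
    intro k
    rcases hcase k with h | h
    · have := hclose k (side k)
      rw [(hw.hasCoord_iff.1 (hx k)).2.2.1, ← h, (hw.hasCoord_iff.1 (hx' k)).2.2.1] at this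
      linarith [(abs_le.1 this).2]
    · linarith [(hx k).1.1]
  -- all terms of this sum are nonnegative, and that of index `i` is at least `x i`
  have hS : ∑ k, α k * (x k + 3 * δ - x' k) = W * (r - r') + 3 * δ * ∑ k, α k := by
    have : ∀ k, α k * (x k + 3 * δ - x' k) = α k * x k - α k * x' k + 3 * δ * α k := by
      intro k; ring
    rw [Finset.sum_congr rfl fun k _ => this k, Finset.sum_add_distrib, Finset.sum_sub_distrib,
      hsum, hsum', Finset.mul_sum]
    ring
  have hi2 : α i * (x i + 3 * δ - x' i) ≤ ∑ k, α k * (x k + 3 * δ - x' k) :=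
    Finset.single_le_sum (f := fun k => α k * (x k + 3 * δ - x' k))
      (fun k _ => mul_nonneg (zero_le_one.trans (hα k)) (by linarith [hle k])) (Finset.mem_univ i)
  have hi1 : x i ≤ α i * (x i + 3 * δ - x' i) := by
    have hxi := (hx i).1.1
    nlinarith [hα i]
  have hWr : W * (r - r') ≤ W * δ :=
    mul_le_mul_of_nonneg_left (by linarith [(abs_lt.1 hr).1]) hW
  have := hδ i
  nlinarith

theorem mainTheorem6
    (w : Fin 3 → Plane) (hw_unit : ∀ j, ‖w j‖ = 1) (hw_sum : w 0 + w 1 + w 2 = 0)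
    {V : Type*} [Finite V] (T : TypedTree V)
    (f : T.Space → Plane) (hf : T.IsImmersion w f)
    (r : ℝ) (hr : 0 < r) (hfr : MemMr w r (T.treeMeasure f))
    -- the attachment points `A i`, their sides `s i`, coordinates `x i` and exit densities `α i`
    (q : ℕ) (A : Fin q → Plane) (s : Fin q → Fin 3) (x α : Fin q → ℝ)
    (hA_inj : Function.Injective A)
    (hA : range A = attachmentPoints w r (T.treeMeasure f))
    (hx : ∀ i, HasCoord w r (A i) (s i) (x i))
    (hα : ∀ i, α i = density (T.treeMeasure f) (A i) (w (s i)))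
    (ε : ℝ) (hε : 0 < ε) :
    ∃ δ : ℝ, 0 < δ ∧
      ∀ (r' : ℝ) (A' : Fin q → Plane) (s' : Fin q → Fin 3) (x' : Fin q → ℝ),
        0 < r' →
        (∀ i, HasCoord w r' (A' i) (s' i) (x' i)) →
        ∑ i, α i * x' i = weight w r (T.treeMeasure f) * r' →
        (∀ i, ‖A' i - A i‖ < δ) →
        (|r' - r| < δ ∨ ∀ i, s' i = s i) →
        ∃ g : T.Space → Plane,
          T.IsImmersion w g ∧
          (∀ t, ‖f t - g t‖ < ε) ∧
          MemMr w r' (T.treeMeasure g) ∧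
          attachmentPoints w r' (T.treeMeasure g) = range A' ∧
          ∀ i, density (T.treeMeasure g) (A' i) (w (s' i)) = α i := by
  classical
  have := Fintype.ofFinite V
  have hw : IsTriad w := ⟨hw_unit, hw_sum⟩
  obtain ⟨sgn, hs⟩ := hf.exists_isSigned
  have hc := hs.isConfined_of_memMr hw hf hr hfr
  obtain ⟨η, hη, hmove⟩ := hc.exists_moved hw hf hε
  -- every leaf with positive coordinate leaves the triangle at one of the points `A i`
  have hidx : ∀ v j, T.nbr j v = none → 0 < sideCoord w r j (f (T.point v)) →
      ∃ i, A i = T.exitPoint w r f v j ∧ s i = j ∧ x i = sideCoord w r j (f (T.point v)) := by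
    intro v j h hpos
    have hmem : T.exitPoint w r f v j ∈ range A := by
      rw [hA]
      exact (hc.mem_attachmentPoints hw hf hr).2 ⟨v, j, h, hpos, rfl⟩
    obtain ⟨i, hi⟩ := hmem
    exact ⟨i, hi, TypedTree.hasCoord_unique hw (hi ▸ hx i) (hc.hasCoord_exitPoint hw hr hpos)⟩
  have hidx' : ∀ i, ∃ v, T.nbr (s i) v = none ∧ x i = sideCoord w r (s i) (f (T.point v)) := by
    intro i
    have hmem : A i ∈ attachmentPoints w r (T.treeMeasure f) := hA ▸ mem_range_self i
    obtain ⟨v, j, h, hpos, e⟩ := (hc.mem_attachmentPoints hw hf hr).1 hmem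
    obtain ⟨rfl, hxi⟩ :=
      TypedTree.hasCoord_unique hw (hx i) (e ▸ hc.hasCoord_exitPoint hw hr hpos)
    exact ⟨v, h, hxi⟩
  have hx_inj : ∀ i k, s i = s k → x i = x k → i = k := by
    intro i k h1 h2
    refine hA_inj ?_
    rw [(hx i).2, (hx k).2, h1, h2]
  have hαcount : ∀ i, α i = ∑ v, if T.nbr (s i) v = none ∧
      sideCoord w r (s i) (f (T.point v)) = x i then (1 : ℝ) else 0 := by
    intro i
    obtain ⟨-, -, e0, e1⟩ := hw.hasCoord_iff.1 (hx i)
    rw [hα, hc.density_exit hw hf hr e1, e0]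
  have hα1 : ∀ i, 1 ≤ α i := by
    intro i
    obtain ⟨v, hv, e⟩ := hidx' i
    rw [hαcount i]
    refine le_trans ?_ (Finset.single_le_sum (f := fun v => if T.nbr (s i) v = none ∧
      sideCoord w r (s i) (f (T.point v)) = x i then (1 : ℝ) else 0)
      (fun v _ => by split_ifs <;> norm_num) (Finset.mem_univ v))
    simp [hv, e]
  -- values at the attachment points, transferred to the leaves
  let lift : (Fin q → ℝ) → V → Fin 3 → ℝ := fun y v j =>
    ∑ i, if s i = j ∧ x i = sideCoord w r j (f (T.point v)) then y i else 0
  have hlift_pos : ∀ y v i, x i = sideCoord w r (s i) (f (T.point v)) →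
      lift y v (s i) = y i := by
    intro y v i h
    simp only [lift]
    rw [Finset.sum_eq_single i]
    · simp [h]
    · intro k _ hk
      rw [if_neg]
      rintro ⟨h1, h2⟩
      exact hk (hx_inj k i h1 (h2.trans h.symm))
    · simp
  have hlift_zero : ∀ y v j, ¬ 0 < sideCoord w r j (f (T.point v)) → lift y v j = 0 := by
    intro y v j h
    refine Finset.sum_eq_zero fun i _ => ?_
    rw [if_neg]
    rintro ⟨-, h2⟩
    exact h (h2 ▸ (hx i).1.1)
  have hlift_sum : ∀ y, ∑ v, ∑ j, (if T.nbr j v = none then lift y v j else 0)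
      = ∑ i, α i * y i := by
    intro y
    have h1 : ∀ v, ∑ j, (if T.nbr j v = none then lift y v j else 0)
        = ∑ i, if T.nbr (s i) v = none ∧ sideCoord w r (s i) (f (T.point v)) = x i
            then y i else 0 := by
      intro v
      have h2 : ∀ j, (if T.nbr j v = none then lift y v j else 0)
          = ∑ i, if s i = j then (if T.nbr (s i) v = none ∧
              sideCoord w r (s i) (f (T.point v)) = x i then y i else 0) else 0 := by
        intro j
        simp only [lift]
        split_ifs with h
        · refine Finset.sum_congr rfl fun i _ => ?_
          by_cases hij : s i = j
          · subst hij
            simp [h, eq_comm]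
          · simp [hij]
        · refine (Finset.sum_eq_zero fun i _ => ?_).symm
          by_cases hij : s i = j
          · subst hij
            simp [h]
          · simp [hij]
      rw [Finset.sum_congr rfl fun j _ => h2 j, Finset.sum_comm]
      simp
    rw [Finset.sum_congr rfl fun v _ => h1 v, Finset.sum_comm]
    refine Finset.sum_congr rfl fun i _ => ?_
    rw [hαcount i, Finset.sum_mul]
    refine Finset.sum_congr rfl fun v _ => ?_
    split_ifs <;> simp
  have hweight := hc.weight_eq hw hf hr
  have hsumx : ∑ i, α i * x i = weight w r (T.treeMeasure f) * r := by
    rw [← hlift_sum, hweight, mul_comm, ← hc.sum_leaf_sideCoord hw r]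
    refine Finset.sum_congr rfl fun v _ => Finset.sum_congr rfl fun j _ => ?_
    split_ifs with h
    · by_cases hpos : 0 < sideCoord w r j (f (T.point v))
      · obtain ⟨i, -, rfl, hxi⟩ := hidx v j h hpos
        rw [hlift_pos x v i hxi, hxi]
      · rw [hlift_zero x v j hpos]
        exact le_antisymm (hc.sideCoord_nonneg hw hr v j) (not_lt.1 hpos)
    · rfl
  have hW : 0 ≤ weight w r (T.treeMeasure f) := by
    rw [hweight, ← hc.card_leaves hw 0]
    exact Finset.sum_nonneg fun v _ => by split_ifs <;> norm_num
  set L : Finset (V × Fin 3) := Finset.univ.filter fun a => T.nbr a.2 a.1 = none with hL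
  have hev1 : ∀ᶠ δ in 𝓝[>] (0 : ℝ),
      ∀ i, (3 * ∑ k, α k + weight w r (T.treeMeasure f) + 3) * δ < x i :=
    eventually_all.2 fun i => eventually_mul_lt _ (hx i).1.1
  have hev2 : ∀ᶠ δ in 𝓝[>] (0 : ℝ), ∀ i k, i ≠ k → 2 * δ < ‖A i - A k‖ := by
    refine eventually_all.2 fun i => eventually_all.2 fun k => ?_
    by_cases h : i = k
    · simp [h]
    · filter_upwards [eventually_mul_lt 2 (norm_pos_iff.2 (sub_ne_zero.2 (hA_inj.ne h)))] with δ hδ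
      exact fun _ => hδ
  obtain ⟨δ, ⟨⟨hδx, hδA⟩, hδη⟩, hδ0⟩ := (((hev1.and hev2).and
    (eventually_mul_lt (L.card * 2) hη)).and self_mem_nhdsWithin).exists
  refine ⟨δ, hδ0, fun r' A' s' x' hr' hx' hsum' hclose hor => ?_⟩
  have hss : ∀ i, s' i = s i := by
    rcases hor with h | h
    · exact side_eq_of_close hw hx hx' hα1 hW hsumx hsum' hclose h hδx
    · exact h
  obtain rfl : s' = s := funext hss
  have hA'_inj : ∀ i k, A' i = A' k → i = k := by
    intro i k h
    by_contra hne
    have h1 : A i - A k = (A' k - A k) - (A' i - A i) := by rw [h]; abel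
    have h2 := norm_sub_le (A' k - A k) (A' i - A i)
    rw [← h1] at h2
    linarith [hδA i k hne, hclose i, hclose k]
  -- the leaves with coordinate `0` move only if their type is `1`, all by the same amount
  have hτ : ∀ a ∈ L, |lift x' a.1 a.2 - sideCoord w r' a.2 (f (T.point a.1))|
      ≤ L.card * (2 * δ) := by
    have hδ0' : 0 ≤ 2 * δ := by linarith [show 0 < δ from hδ0]
    refine abs_le_of_sum_eq_zero (ρ := r - r') hδ0' ?_ ?_
    · rintro ⟨v, j⟩ ha
      have h : T.nbr j v = none := (Finset.mem_filter.1 ha).2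
      by_cases hpos : 0 < sideCoord w r j (f (T.point v))
      · left
        obtain ⟨i, hi, rfl, hxi⟩ := hidx v j h hpos
        have e1 : sideCoord w r' (s' i) (A' i) = x' i := (hw.hasCoord_iff.1 (hx' i)).2.2.1
        have e2 : sideCoord w r' (s' i) (f (T.point v)) = sideCoord w r' (s' i) (A i) := by
          rw [hi, TypedTree.exitPoint, sideCoord_add, map_smul, hw.sideForm_self]; simp
        simp only
        rw [hlift_pos x' v i hxi, e2, ← e1, sideCoord_sub_sideCoord]
        exact (hw.abs_sideForm_le _ _).trans (mul_le_mul_of_nonneg_left (hclose i).le zero_le_two)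
      · have h0 := le_antisymm (not_lt.1 hpos) (hc.sideCoord_nonneg hw hr v j)
        simp only
        rw [hlift_zero x' v j hpos]
        simp only [sideCoord] at h0 ⊢
        by_cases hj : j = 1
        · right
          rw [if_pos hj] at h0 ⊢
          linarith
        · left
          rw [if_neg hj] at h0 ⊢
          rw [h0, sub_zero, abs_zero]
          exact hδ0'
    · have e1 := hlift_sum x'
      have e2 := hc.sum_leaf_sideCoord hw r'
      rw [hsum', hweight] at e1
      rw [Finset.sum_sub_distrib, hL, Finset.sum_filter, Finset.sum_filter, Fintype.sum_prod_type,
        Fintype.sum_prod_type, e1, e2]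
      ring
  obtain ⟨g, hg, hcg, hfg, hgt⟩ := hmove r' (lift x') hr'
    (fun v j _ => Finset.sum_nonneg fun i _ => by
      split_ifs
      · exact (hx' i).1.1.le
      · exact le_rfl)
    (by rw [hlift_sum, hsum', hweight, mul_comm])
    (fun v j h => (hτ (v, j) (Finset.mem_filter.2 ⟨Finset.mem_univ _, h⟩)).trans
      (by rw [← mul_assoc]; exact hδη.le))
  -- a leaf of `f` that exits at `A i` corresponds to a leaf of `g` that exits at `A' i`
  have hexit : ∀ v i, T.nbr (s' i) v = none → x i = sideCoord w r (s' i) (f (T.point v)) →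
      0 < sideCoord w r' (s' i) (g (T.point v)) ∧ T.exitPoint w r' g v (s' i) = A' i := by
    intro v i h hxi
    have e : sideCoord w r' (s' i) (g (T.point v)) = x' i := by
      rw [hgt v _ h, hlift_pos x' v i hxi]
    have hpos : 0 < sideCoord w r' (s' i) (g (T.point v)) := e ▸ (hx' i).1.1
    refine ⟨hpos, ?_⟩
    rw [(hcg.hasCoord_exitPoint hw hr' hpos).2, (hx' i).2, e]
  have hpos_of : ∀ v j, T.nbr j v = none → 0 < sideCoord w r' j (g (T.point v)) →
      0 < sideCoord w r j (f (T.point v)) := by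
    intro v j h hpos
    by_contra hn
    rw [hgt v j h, hlift_zero x' v j hn] at hpos
    exact lt_irrefl _ hpos
  refine ⟨g, hg, hfg, hcg.memMr hw hg hr', ?_, fun i => ?_⟩
  · ext P
    rw [hcg.mem_attachmentPoints hw hg hr']
    constructor
    · rintro ⟨v, j, h, hpos, rfl⟩
      obtain ⟨i, -, rfl, hxi⟩ := hidx v j h (hpos_of v j h hpos)
      exact ⟨i, (hexit v i h hxi).2.symm⟩
    · rintro ⟨i, rfl⟩
      obtain ⟨v, h, hxi⟩ := hidx' i
      exact ⟨v, s' i, h, (hexit v i h hxi).1, (hexit v i h hxi).2.symm⟩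
  · obtain ⟨-, -, e0, e1⟩ := hw.hasCoord_iff.1 (hx' i)
    rw [hcg.density_exit hw hg hr' e1, e0, hαcount i]
    refine Finset.sum_congr rfl fun v _ => if_congr (and_congr_right fun h => ?_) rfl rfl
    constructor
    · intro e
      have hpos := hpos_of v (s' i) h (e ▸ (hx' i).1.1)
      obtain ⟨k, -, hk, hxk⟩ := hidx v (s' i) h hpos
      have hk' : T.nbr (s' k) v = none := hk ▸ h
      have hxk' : x k = sideCoord w r (s' k) (f (T.point v)) := hk ▸ hxk
      have hki : k = i := by
        refine hA'_inj k i ?_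
        rw [(hx' k).2, (hx' i).2, hk, ← e, hgt v _ h, ← hk, hlift_pos x' v k hxk']
      rw [← hxk, hki]
    · intro e
      rw [hgt v _ h, hlift_pos x' v i e.symm]
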